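/- Let $\kappa$ be an infinite regular cardinal and $\lambda>\kappa^+$ a regular cardinal with $2^\kappa\le\lambda$. For ordinals $\alpha,\beta$ let $(\beta)^{\alpha}$ be the set of strictly increasing maps $\alpha\to\beta$, let $(\lambda)^{<\kappa^+}=\bigcup_{\gamma<\kappa^+}(\lambda)^{\gamma}$, and let $\triangleleft$ be a well-ordering of $(\lambda)^{<\kappa^+}$ of order type $\lambda$. Functions are identified with their graphs, and for a set $a$ of ordinals $\mathrm{ssup}(a)$ is the least $\xi$ with $a\subseteq\xi$. Limit ordinals are non-zero. *Models.* A set $N$ is a *very good model* if $(N,\in)\prec(H_\lambda,\in)$, $\delta^N:=\kappa^+\cap N$ is an ordinal $<\kappa^+$, $\kappa^+\in N$, $|N|=\kappa$, and $(N,\in,\triangleleft)\prec(H_\lambda,\in,\triangleleft)$. Let $\overline N$ be the transitive collapse of $N$. For increasing $f:\theta\to\lambda$, $N$ *fits* $f$ if $\mathrm{rge}(f)=N\cap\lambda$. *Segments.* A *small $(\kappa^+,1)$-simplified morass segment* is $S=\langle\langle\theta_i\rangle_{i\le\zeta},\langle\mathcal F_{ij}\rangle_{i\le j\le\zeta}\rangle$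 with $\zeta<\kappa$ such that - $\langle\theta_i\rangle_{i\le\zeta}$ is a strictly increasing sequence of ordinals $<\kappa^+$, and $\mathrm{cf}(\theta_i)<\kappa$ if $i$ is a limit ordinal; - $\mathcal F_{ij}\subseteq(\theta_j)^{\theta_i}$, $|\mathcal F_{ij}|<\kappa$, and $\mathcal F_{ii}=\{\mathrm{id}\}$; - for $i<\zeta$, either $\mathcal F_{i,i+1}=\{f_i\}$ with $\mathrm{ssup}(\mathrm{rge} f_i)<\theta_{i+1}$, or $\mathcal F_{i,i+1}=\{\mathrm{id},h\}$ where, for some $\sigma<\theta_i$, $h\restriction\sigma=\mathrm{id}$, $h(\sigma+\xi)=\theta_i+\xi$ whenever $\sigma+\xi<\theta_i$, and $\theta_i\cup h''\theta_i$ is an ordinal $\rho$ with $\theta_{i+1}=\rho+1$; - if $k\le\zeta$ is a limit ordinal, $i_0,i_1<k$, $g_0\in\mathcal F_{i_0k}$ and $g_1\in\mathcal F_{i_1k}$, then there are $j\in[\max(i_0,i_1),k)$, $h\in\mathcal F_{jk}$, $g_0'\in\mathcal F_{i_0j}$, $g_1'\in\mathcal F_{i_1j}$ with $g_0=h\circ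 g_0'$ and $g_1=h\circ g_1'$; - $\mathcal F_{ik}=\{g\circ f: f\in\mathcal F_{ij},\ g\in\mathcal F_{jk}\}$ for $i\le j\le k\le\zeta$. *The forcing.* $\mathbb P$ consists of a largest element $\mathbb 1$ and of all triples $p=(S^p,F^p,\mathcal N^p)$, where $S^p$ is a small $(\kappa^+,1)$-simplified morass segment (with data $\zeta^p,\theta^p_i,\mathcal F^p_{ij}$), $F^p\in(\lambda)^{\theta^p_{\zeta^p}}$, and $\mathcal N^p$ is a set of very good models such that for every $M\in\mathcal N^p$ there is a unique pair $(i^M,f^M)$ with $i^M\le\zeta^p$, $f^M\in\mathcal F^p_{i^M\zeta^p}$ and $M$ fitting $F^p\circ f^M$ (the *witness* of $M$ in $p$), and - ($\circ_1$) $\mathcal F^p_{ij}\subseteq\overline M$ for all $i\le j\le i^M$ with $i<i^M$; - ($\circ_2$) for all $N\in\mathcal N^p$ with $i^N\le i^M$, all $\gamma<\delta^N$ and all $g\in(\theta^p_{i^N})^{\gamma}$: if $g\in\overline N$ then $g\in\overline M$. For $p,q\neq\mathbb 1$, put $q\le p$ iff there are a strictly increasing $k:\zeta^p+1\to\zeta^q+1$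 and $f\in\mathcal F^q_{k(\zeta^p)\zeta^q}$ such that $\theta^p_i=\theta^q_{k(i)}$; $\mathcal F^p_{ij}\subseteq\mathcal F^q_{k(i)k(j)}$ for $i\le j\le\zeta^p$; $\mathcal F^p_{i,i+1}=\mathcal F^q_{k(i),k(i)+1}$ whenever $i<\zeta^p$ and $k(i+1)=k(i)+1$; $F^p=F^q\circ f$; $\mathcal N^p\subseteq\mathcal N^q$; and every $N\in\mathcal N^q$ whose witness in $q$ is $(k(i),f\circ g)$ for some $i\le\zeta^p$ and $g\in\mathcal F^p_{i\zeta^p}$ belongs to $\mathcal N^p$. **Proposition.** $\mathbb P$ is ${<}\kappa$-closed: for every ordinal $\mu<\kappa$ and every sequence $\langle p_\alpha\rangle_{\alpha<\mu}$ in $\mathbb P$ with $p_\beta\le p_\alpha$ for all $\alpha\le\beta<\mu$, there is $q\in\mathbb P$ with $q\le p_\alpha$ for all $\alpha<\mu$. -/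

import Mathlib

open Set Cardinal

universe u v

/-! ### Order-preserving maps between ordinals -/

/-- Set-theoretic functions from ordinals to ordinals, as partial functions on the class of
ordinals; the domain is part of the function, a codomain is not. -/
abbrev OrdMap := Ordinal.{u} →. Ordinal.{u}

namespace OrdMap

/-- `f : α ⟶ β` is order preserving: the domain is exactly `α`, the values lie below `β`, and `f`
is strictly increasing. The set of these `f` is `(β)^α`. -/
structure IsOP (f : OrdMap.{u}) (α β : Ordinal.{u}) : Prop where
  dom : f.Dom = Iio α
  lt : ∀ x y, y ∈ f x → y < β
  strictMono : ∀ x x' y y', y ∈ f x → y' ∈ f x' → x < x' → y < y'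

/-- The identity map of the ordinal `θ`. -/
def idOn (θ : Ordinal.{u}) : OrdMap.{u} := PFun.res id (Iio θ)

/-- The set-theoretic graph of `f` is the set `z`. -/
def IsGraph (f : OrdMap.{u}) (z : ZFSet.{u}) : Prop :=
  ∀ w, w ∈ z ↔ ∃ x y, y ∈ f x ∧ w = ZFSet.pair x.toZFSet y.toZFSet

/-- `f`, as a set of ordered pairs, is an element of `A`. -/
def MemSet (f : OrdMap.{u}) (A : ZFSet.{u}) : Prop :=
  ∃ z ∈ A, IsGraph f z

end OrdMap

/-- `ssup a` is the least ordinal `ξ` with `a ⊆ ξ`. -/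
noncomputable def ssup (a : Set Ordinal.{u}) : Ordinal.{u} := sInf {ξ | a ⊆ Iio ξ}

/-- `{id, h} ⊆ (φ)^τ` is an almost exact amalgamation pair. -/
def IsAlmostExactAmalgamationPair (𝓕 : Set OrdMap.{u}) (τ φ : Ordinal.{u}) : Prop :=
  ∃ h : OrdMap.{u}, 𝓕 = {OrdMap.idOn τ, h} ∧ (OrdMap.idOn τ).IsOP τ φ ∧ h.IsOP τ φ ∧
    (∃ σ < τ, (∀ x < σ, x ∈ h x) ∧ ∀ ξ, σ + ξ < τ → τ + ξ ∈ h (σ + ξ)) ∧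
    ∃ ρ, Iio τ ∪ h.ran = Iio ρ ∧ φ = ρ + 1

/-! ### Good and very good models -/

/-- `H_χ`, the sets whose transitive closure has cardinality `< χ`. -/
def Hset (χ : Cardinal.{u}) : Set ZFSet.{u} :=
  {x | ∃ t : ZFSet.{u}, t.IsTransitive ∧ x ⊆ t ∧ t.card < χ}

/-- The binary symbol of the language of set theory. -/
inductive SetRel₁ : ℕ → Type
  | mem : SetRel₁ 2

/-- The two binary symbols of the language of set theory with an added relation. -/
inductive SetRel₂ : ℕ → Type
  | mem : SetRel₂ 2
  | tri : SetRel₂ 2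

/-- The language `{∈}`. -/
def langMem : FirstOrder.Language := ⟨fun _ => Empty, SetRel₁⟩

/-- The language `{∈, ◁}`. -/
def langMemTri : FirstOrder.Language := ⟨fun _ => Empty, SetRel₂⟩

/-- `(A, ∈)`. -/
@[reducible] def memStructure (A : Set ZFSet.{u}) : langMem.Structure A where
  funMap := fun f => Empty.elim f
  RelMap
    | .mem => fun x => (x 0).1 ∈ (x 1).1

/-- `(λ)^{<κ⁺}`: the order-preserving maps (as sets of pairs) from an ordinal `< κ⁺` to `λ`. -/
def incSeqs (κ lam : Cardinal.{u}) : Set ZFSet.{u} :=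
  {z | ∃ γ < (Order.succ κ).ord, ∃ f : OrdMap.{u}, f.IsOP γ lam.ord ∧ f.IsGraph z}

/-- `(A, ∈, ◁)`, for a relation `◁` on `(λ)^{<κ⁺}`. -/
@[reducible] def memTriStructure {κ lam : Cardinal.{u}}
    (tri : incSeqs κ lam → incSeqs κ lam → Prop) (A : Set ZFSet.{u}) :
    langMemTri.Structure A where
  funMap := fun f => Empty.elim f
  RelMap
    | .mem => fun x => (x 0).1 ∈ (x 1).1
    | .tri => fun x => ∃ (h₀ : (x 0).1 ∈ incSeqs κ lam) (h₁ : (x 1).1 ∈ incSeqs κ lam),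
        tri ⟨_, h₀⟩ ⟨_, h₁⟩

/-- `(N, ∈) ≺ (A, ∈)`. -/
def IsElemMem (N : ZFSet.{u}) (A : Set ZFSet.{u}) : Prop :=
  letI := memStructure A
  (∀ x ∈ N, x ∈ A) ∧ ∃ S : langMem.ElementarySubstructure A, ∀ x : A, x ∈ S ↔ x.1 ∈ N

/-- `(N, ∈, ◁) ≺ (A, ∈, ◁)`. -/
def IsElemMemTri {κ lam : Cardinal.{u}} (tri : incSeqs κ lam → incSeqs κ lam → Prop)
    (N : ZFSet.{u}) (A : Set ZFSet.{u}) : Prop :=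
  letI := memTriStructure tri A
  (∀ x ∈ N, x ∈ A) ∧ ∃ S : langMemTri.ElementarySubstructure A, ∀ x : A, x ∈ S ↔ x.1 ∈ N

/-- `κ⁺ ∩ N`. -/
def ordTrace (κ : Cardinal.{u}) (N : ZFSet.{u}) : Set Ordinal.{u} :=
  {α | α < (Order.succ κ).ord ∧ α.toZFSet ∈ N}

/-- `δ^N`: when `κ⁺ ∩ N` is an ordinal (as it is for good models), this is that ordinal. -/
noncomputable def modelDelta (κ : Cardinal.{u}) (N : ZFSet.{u}) : Ordinal.{u} :=
  ssup (ordTrace κ N)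

/-- Good models. -/
structure IsGoodModel (κ lam : Cardinal.{u}) (N : ZFSet.{u}) : Prop where
  elementary : IsElemMem N (Hset lam)
  trace_eq : ordTrace κ N = Iio (modelDelta κ N)
  delta_lt : modelDelta κ N < (Order.succ κ).ord
  succ_mem : (Order.succ κ).ord.toZFSet ∈ N
  card_eq : N.card = κ

/-- Very good models. -/
structure IsVeryGoodModel {κ lam : Cardinal.{u}} (tri : incSeqs κ lam → incSeqs κ lam → Prop)
    (N : ZFSet.{u}) : Prop extends IsGoodModel κ lam N where
  elementary_tri : IsElemMemTri tri N (Hset lam)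

/-- The Mostowski collapsing map of `N`, `x ↦ {collapse y | y ∈ x ∩ N}`. -/
noncomputable def collapseMap (N : ZFSet.{u}) (x : ZFSet.{u}) : ZFSet.{u} :=
  ZFSet.range (fun y : (x ∩ N : ZFSet.{u}) => collapseMap N y.1)
termination_by x
decreasing_by exact (ZFSet.mem_inter.1 y.2).1

/-- The transitive collapse of `N`. -/
noncomputable def collapse (N : ZFSet.{u}) : ZFSet.{u} :=
  ZFSet.range (fun y : N => collapseMap N y.1)

/-- `N` fits `f`: the range of `f` is `N ∩ λ`. -/
def Fits (lam : Cardinal.{u}) (N : ZFSet.{u}) (f : OrdMap.{u}) : Prop :=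
  f.ran = {α | α < lam.ord ∧ α.toZFSet ∈ N}

/-! ### Small simplified morass segments -/

/-- A small `(κ⁺, 1)`-simplified morass segment. The levels are the ordinals `i ≤ ζ`; only the
sets `F i j` with `i ≤ j` are part of the data, and the others are set to `∅`. -/
structure SMS (κ : Cardinal.{u}) where
  ζ : Ordinal.{u}
  θ : Iic ζ → Ordinal.{u}
  F : Iic ζ → Iic ζ → Set OrdMap.{u}
  F_of_lt : ∀ i j, j < i → F i j = ∅
  ζ_lt : ζ < κ.ord
  θ_lt : ∀ i, θ i < (Order.succ κ).ord
  θ_strictMono : StrictMono θ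
  cof_lt : ∀ i : Iic ζ, Order.IsSuccLimit (i : Ordinal.{u}) → (θ i).cof < κ
  F_isOP : ∀ i j, i ≤ j → ∀ f ∈ F i j, f.IsOP (θ i) (θ j)
  F_card : ∀ i j, i ≤ j → #(F i j) < Cardinal.lift.{u + 1} κ
  F_self : ∀ i, F i i = {OrdMap.idOn (θ i)}
  F_succ : ∀ i j : Iic ζ, (j : Ordinal.{u}) = i + 1 →
    (∃ f : OrdMap.{u}, F i j = {f} ∧ ssup f.ran < θ j) ∨
      IsAlmostExactAmalgamationPair (F i j) (θ i) (θ j)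
  directed : ∀ k : Iic ζ, Order.IsSuccLimit (k : Ordinal.{u}) →
    ∀ i₀ i₁, i₀ < k → i₁ < k → ∀ g₀ ∈ F i₀ k, ∀ g₁ ∈ F i₁ k,
      ∃ j, max i₀ i₁ ≤ j ∧ j < k ∧ ∃ h ∈ F j k, ∃ g₀' ∈ F i₀ j, ∃ g₁' ∈ F i₁ j,
        g₀ = h.comp g₀' ∧ g₁ = h.comp g₁'
  factor : ∀ i j k, i ≤ j → j ≤ k →
    F i k = {h | ∃ f ∈ F i j, ∃ g ∈ F j k, h = g.comp f}

/-- The top level `ζ`. -/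
def SMS.top {κ : Cardinal.{u}} (S : SMS κ) : Iic S.ζ := ⟨S.ζ, le_refl S.ζ⟩

/-! ### The forcing -/

/-- The pair `(i, f)` witnesses that `N` fits the map `F · f`, where `F` is the map of a condition
with morass segment `S`. -/
def IsWitness {κ : Cardinal.{u}} (lam : Cardinal.{u}) (S : SMS κ) (F : OrdMap.{u})
    (N : ZFSet.{u}) (i : Iic S.ζ) (f : OrdMap.{u}) : Prop :=
  f ∈ S.F i S.top ∧ Fits lam N (F.comp f)

/-- The conditions other than the trivial one. -/
structure Condition {κ lam : Cardinal.{u}}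
    (tri : incSeqs κ lam → incSeqs κ lam → Prop) where
  S : SMS κ
  F : OrdMap.{u}
  𝒩 : Set ZFSet.{u}
  F_isOP : F.IsOP (S.θ S.top) lam.ord
  veryGood : ∀ M ∈ 𝒩, IsVeryGoodModel tri M
  witness : ∀ M ∈ 𝒩, ∃! w : Iic S.ζ × OrdMap.{u}, IsWitness lam S F M w.1 w.2
  circ₁ : ∀ M ∈ 𝒩, ∀ iM fM, IsWitness lam S F M iM fM →
    ∀ i j, i ≤ j → j ≤ iM → i < iM → ∀ f ∈ S.F i j, f.MemSet (collapse M)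
  circ₂ : ∀ M ∈ 𝒩, ∀ iM fM, IsWitness lam S F M iM fM →
    ∀ N ∈ 𝒩, ∀ iN fN, IsWitness lam S F N iN fN →
      ∀ γ < modelDelta κ N, ∀ g : OrdMap.{u}, g.IsOP γ (S.θ iN) →
        iN ≤ iM → g.MemSet (collapse N) → g.MemSet (collapse M)

namespace Condition

variable {κ lam : Cardinal.{u}} {tri : incSeqs κ lam → incSeqs κ lam → Prop}

/-- The relation `q ≤ p` between nontrivial conditions. -/
def Extends (q p : Condition tri) : Prop :=
  ∃ k : Iic p.S.ζ ↪o Iic q.S.ζ,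
    (∀ i, p.S.θ i = q.S.θ (k i)) ∧
    (∀ i j, i ≤ j → p.S.F i j ⊆ q.S.F (k i) (k j)) ∧
    (∀ i j : Iic p.S.ζ, (j : Ordinal.{u}) = i + 1 → (k j : Ordinal.{u}) = k i + 1 →
      p.S.F i j = q.S.F (k i) (k j)) ∧
    ∃ f ∈ q.S.F (k p.S.top) q.S.top,
      p.F = q.F.comp f ∧ p.𝒩 ⊆ q.𝒩 ∧
      ∀ N ∈ q.𝒩, ∀ i, ∀ g ∈ p.S.F i p.S.top,
        IsWitness lam q.S q.F N (k i) (f.comp g) → N ∈ p.𝒩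

theorem comp_idOn {f : OrdMap.{u}} {α β : Ordinal.{u}} (h : f.IsOP α β) :
    f.comp (OrdMap.idOn α) = f := by
  funext x
  ext y
  have hd : y ∈ f x → x < α := fun hy => by
    have : x ∈ f.Dom := (PFun.mem_dom _ _).2 ⟨y, hy⟩
    rwa [h.dom] at this
  refine Iff.trans Part.mem_bind_iff ?_
  constructor
  · rintro ⟨a, ha, hy⟩
    obtain ⟨-, rfl⟩ := (PFun.mem_res id (Iio α) x a).1 ha
    exact hy
  · intro hy
    exact ⟨x, (PFun.mem_res id (Iio α) x x).2 ⟨hd hy, rfl⟩, hy⟩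

theorem Extends.refl (p : Condition tri) : p.Extends p := by
  refine ⟨(OrderIso.refl _).toOrderEmbedding, fun _ => rfl, fun _ _ _ => Subset.rfl,
    fun _ _ _ _ => rfl, OrdMap.idOn (p.S.θ p.S.top), ?_, (comp_idOn p.F_isOP).symm,
    Subset.rfl, fun _ h _ _ _ _ => h⟩
  change _ ∈ p.S.F p.S.top p.S.top
  rw [p.S.F_self]
  exact mem_singleton _

theorem le_top (p : Condition tri) (i : Iic p.S.ζ) : i ≤ p.S.top := i.2

theorem Extends.trans {r q p : Condition tri} (hrq : r.Extends q) (hqp : q.Extends p) :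
    r.Extends p := by
  obtain ⟨l, hl1, hl2, hl3, g, hg, hFg, hNg, hWg⟩ := hrq
  obtain ⟨k, hk1, hk2, hk3, f, hf, hFf, hNf, hWf⟩ := hqp
  refine ⟨k.trans l, fun i => (hk1 i).trans (hl1 _), fun i j hij =>
    (hk2 i j hij).trans (hl2 _ _ (k.monotone hij)), ?_, g.comp f, ?_, ?_, hNf.trans hNg, ?_⟩
  · intro i j hij hlk
    have hijlt : i < j := by
      rw [← Subtype.coe_lt_coe, hij]
      exact Order.lt_add_one_iff.2 le_rfl
    have hk : (k j : Ordinal.{u}) = k i + 1 := by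
      by_contra hne
      have h1 : (k i : Ordinal.{u}) + 1 < k j :=
        lt_of_le_of_ne (Order.add_one_le_of_lt (k.strictMono hijlt)) (Ne.symm hne)
      let m : Iic q.S.ζ := ⟨(k i : Ordinal.{u}) + 1, h1.le.trans (k j).2⟩
      have ha : k i < m := by
        rw [← Subtype.coe_lt_coe]
        exact Order.lt_add_one_iff.2 le_rfl
      have hb : m < k j := h1
      have h2 : (l (k i) : Ordinal.{u}) < l m := l.strictMono ha
      have h3 : (l m : Ordinal.{u}) < l (k j) := l.strictMono hb
      have h4 : (l (k j) : Ordinal.{u}) = l (k i) + 1 := hlk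
      rw [h4] at h3
      exact absurd h2 (not_lt.2 (Order.lt_add_one_iff.1 h3))
    exact (hk3 i j hij hk).trans (hl3 _ _ hk hlk)
  · have h1 : l (k p.S.top) ≤ l q.S.top := l.monotone (le_top q _)
    change _ ∈ r.S.F (l (k p.S.top)) r.S.top
    rw [r.S.factor _ _ _ h1 (le_top r _)]
    exact ⟨f, hl2 _ _ (le_top q _) hf, g, hg, rfl⟩
  · rw [hFf, hFg, PFun.comp_assoc]
  · intro N hN i e he hw
    have hfe : f.comp e ∈ q.S.F (k i) q.S.top := by
      rw [q.S.factor _ (k p.S.top) _ (k.monotone (le_top p i)) (le_top q _)]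
      exact ⟨e, hk2 _ _ (le_top p i) he, f, hf, rfl⟩
    rw [PFun.comp_assoc] at hw
    have hNq : N ∈ q.𝒩 := hWg N hN (k i) (f.comp e) hfe hw
    refine hWf N hNq i e he ⟨hfe, ?_⟩
    have := hw.2
    rwa [← PFun.comp_assoc, ← hFg] at this

instance : Preorder (Condition tri) where
  le q p := q.Extends p
  le_refl := Extends.refl
  le_trans _ _ _ := Extends.trans

end Condition

/-- The forcing `ℙ`: the nontrivial conditions together with a largest, trivial condition. -/
abbrev MorassForcing {κ lam : Cardinal.{u}} (tri : incSeqs κ lam → incSeqs κ lam → Prop) :=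
  WithTop (Condition tri)

/-- `P` is `<κ`-closed: every descending sequence of length `< κ` has a lower bound. -/
def IsLTClosed (κ : Cardinal.{u}) (P : Type v) [Preorder P] : Prop :=
  ∀ μ < κ.ord, ∀ p : Iio μ → P, Antitone p → ∃ q, ∀ α, q ≤ p α

/-! Let `p α` be a descending chain of fewer than `κ` nontrivial conditions. The natural lower bound
is the union of the segments with a new top level above it, and the union of the sets of models.

The top. The ranges of the maps `F` of the chain together have at most `κ` elements, so, `lam` being
regular and above `κ⁺`, one increasing `G` with domain `o + 1` covers them (`exists_isOP_covering`),
with each `(p α).F = G ∘ h α` and `h α` landing in `o`. Each segment receives the top level `o + 1`,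
reached from its old top by `h α` alone (`IsSegment.addTop`). Since `G` is injective, the `h α`
cohere, and the enlarged segments still form a chain (`SegExt.addTop`).

Directedness of the union. A limit level `b` of the union may be a successor at every stage. If it
is a limit, or is reached by a single map, at some late stage, directedness is inherited. Otherwise
`b = m + τ + 1` with `m = σ + τ` at every late stage, where `m` is the predecessor of `b`. At a
stage with minimal `τ`, ordinal arithmetic (`add_right_cancel_of_add_mul_two`) forbids `m` to grow
later, so `b` would not be a limit (`IsSegment.iUnion`).

Cofinalities. A limit level `b` of the union may have cofinality at least `κ`. Then at each stage
everything below `b` is bounded strictly below `b`, and as there are fewer than `κ` stages, one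
bound `ν < b` serves all (`exists_bound_iUnion`). A level `ν` is inserted just below `b`, with the
identity as only map to `b` and with restrictions of old maps elsewhere. This turns `b` into a
successor level, and `ν` has small cofinality (`IsBounding.isSegment`, `IsBounding.hasSmallCof`).

The models. Witnesses are lifted along `h α`, and they are unique because an increasing map is
determined by its range. The only maps not already controlled by a stage are restrictions and
identities, which a collapse contains by elementarity (`IsElemMem.restrict_memSet`,
`IsElemMem.idOn_memSet`). The second condition on models is inherited from a common stage. -/

namespace OrdMap

/-! ### Calculus of increasing maps. -/

variable {f g h : OrdMap.{u}} {α β γ δ x y : Ordinal.{u}}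

theorem mem_comp : y ∈ g.comp f x ↔ ∃ z, z ∈ f x ∧ y ∈ g z := by
  rw [PFun.comp_apply]
  exact Part.mem_bind_iff

theorem mem_idOn : y ∈ idOn α x ↔ x < α ∧ x = y := PFun.mem_res id (Iio α) x y

theorem mem_comp_idOn : y ∈ f.comp (idOn α) x ↔ x < α ∧ y ∈ f x := by
  simp only [mem_comp, mem_idOn]
  constructor
  · rintro ⟨z, ⟨h, rfl⟩, hy⟩
    exact ⟨h, hy⟩
  · rintro ⟨h, hy⟩
    exact ⟨x, ⟨h, rfl⟩, hy⟩

namespace IsOP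

theorem lt_dom (hf : f.IsOP α β) (hy : y ∈ f x) : x < α := by
  have : x ∈ f.Dom := (PFun.mem_dom _ _).2 ⟨y, hy⟩
  rwa [hf.dom] at this

theorem exists_mem (hf : f.IsOP α β) (hx : x < α) : ∃ y, y ∈ f x := by
  have : x ∈ f.Dom := by
    rw [hf.dom]
    exact hx
  exact (PFun.mem_dom _ _).1 this

theorem of_mem (hd : ∀ x, (∃ y, y ∈ f x) ↔ x < α) (hl : ∀ x y, y ∈ f x → y < β)
    (hm : ∀ x x' y y', y ∈ f x → y' ∈ f x' → x < x' → y < y') : f.IsOP α β :=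
  ⟨by ext x; rw [PFun.mem_dom, hd]; rfl, hl, hm⟩

theorem injective (hf : f.IsOP α β) {x x' y : Ordinal.{u}} (h : y ∈ f x) (h' : y ∈ f x') :
    x = x' := by
  rcases lt_trichotomy x x' with hlt | rfl | hlt
  · exact absurd (hf.strictMono _ _ _ _ h h' hlt) (lt_irrefl _)
  · rfl
  · exact absurd (hf.strictMono _ _ _ _ h' h hlt) (lt_irrefl _)

theorem lt_of_lt (hf : f.IsOP α β) {x x' y y' : Ordinal.{u}} (h : y ∈ f x) (h' : y' ∈ f x')
    (hlt : y < y') : x < x' := by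
  rcases lt_trichotomy x x' with hx | rfl | hx
  · exact hx
  · exact absurd hlt (Part.mem_unique h h' ▸ lt_irrefl _)
  · exact absurd hlt (hf.strictMono _ _ _ _ h' h hx).not_gt

theorem mono (hf : f.IsOP α β) (h : β ≤ γ) : f.IsOP α γ :=
  ⟨hf.dom, fun x y hy => (hf.lt x y hy).trans_le h, hf.strictMono⟩

theorem le_apply (hf : f.IsOP α β) (hy : y ∈ f x) : x ≤ y := by
  induction x using WellFoundedLT.induction generalizing y with
  | ind x ih =>
    by_contra! hlt
    obtain ⟨z, hz⟩ := hf.exists_mem (hlt.trans (hf.lt_dom hy))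
    exact ((ih y hlt hz).trans_lt (hf.strictMono _ _ _ _ hz hy hlt)).false

theorem le (hf : f.IsOP α β) : α ≤ β := by
  by_contra! hlt
  obtain ⟨z, hz⟩ := hf.exists_mem hlt
  exact ((hf.le_apply hz).trans_lt (hf.lt _ _ hz)).false

protected theorem comp (hg : g.IsOP β γ) (hf : f.IsOP α β) : IsOP (g.comp f) α γ := by
  refine of_mem (fun x => ⟨?_, fun hx => ?_⟩) ?_ ?_
  · rintro ⟨y, hy⟩
    obtain ⟨z, hz, -⟩ := mem_comp.1 hy
    exact hf.lt_dom hz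
  · obtain ⟨z, hz⟩ := hf.exists_mem hx
    obtain ⟨y, hy⟩ := hg.exists_mem (hf.lt _ _ hz)
    exact ⟨y, mem_comp.2 ⟨z, hz, hy⟩⟩
  · intro x y hy
    obtain ⟨z, -, hz⟩ := mem_comp.1 hy
    exact hg.lt _ _ hz
  · intro x x' y y' hy hy' hlt
    obtain ⟨z, hz, hzy⟩ := mem_comp.1 hy
    obtain ⟨z', hz', hzy'⟩ := mem_comp.1 hy'
    exact hg.strictMono _ _ _ _ hzy hzy' (hf.strictMono _ _ _ _ hz hz' hlt)

/-- Injectivity of `h`. It transfers coherence from the maps into `lam` to the maps into the new top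
level, and it gives uniqueness of witnesses. -/
theorem cancel (hh : h.IsOP β γ) (hf : f.IsOP α β) (hg : g.IsOP δ β)
    (he : h.comp f = h.comp g) : f = g := by
  refine PFun.ext fun x y => ⟨fun hy => ?_, fun hy => ?_⟩
  · obtain ⟨z, hz⟩ := hh.exists_mem (hf.lt _ _ hy)
    have : z ∈ h.comp g x := he ▸ mem_comp.2 ⟨y, hy, hz⟩
    obtain ⟨w, hw, hwz⟩ := mem_comp.1 this
    rwa [hh.injective hz hwz]
  · obtain ⟨z, hz⟩ := hh.exists_mem (hg.lt _ _ hy)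
    have : z ∈ h.comp f x := he ▸ mem_comp.2 ⟨y, hy, hz⟩
    obtain ⟨w, hw, hwz⟩ := mem_comp.1 this
    rwa [hh.injective hz hwz]

theorem restrict (hf : f.IsOP α β) (h : γ ≤ α) : IsOP (f.comp (idOn γ)) γ β := by
  refine of_mem (fun x => ⟨?_, fun hx => ?_⟩) ?_ ?_
  · rintro ⟨y, hy⟩
    exact (mem_comp_idOn.1 hy).1
  · obtain ⟨y, hy⟩ := hf.exists_mem (hx.trans_le h)
    exact ⟨y, mem_comp_idOn.2 ⟨hx, hy⟩⟩
  · intro x y hy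
    exact hf.lt _ _ (mem_comp_idOn.1 hy).2
  · intro x x' y y' hy hy' hlt
    exact hf.strictMono _ _ _ _ (mem_comp_idOn.1 hy).2 (mem_comp_idOn.1 hy').2 hlt

theorem idOn_comp (hf : f.IsOP α β) (h : β ≤ γ) : (idOn γ).comp f = f := by
  refine PFun.ext fun x y => ?_
  simp only [mem_comp, mem_idOn]
  constructor
  · rintro ⟨z, hz, -, rfl⟩
    exact hz
  · intro hy
    exact ⟨y, hy, (hf.lt _ _ hy).trans_le h, rfl⟩

theorem comp_idOn_of_le (hf : f.IsOP α β) (h : α ≤ γ) : f.comp (idOn γ) = f := by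
  refine PFun.ext fun x y => ?_
  rw [mem_comp_idOn]
  exact ⟨And.right, fun hy => ⟨(hf.lt_dom hy).trans_le h, hy⟩⟩

/-- An increasing map with range inside that of `g` factors through `g`. -/
theorem exists_factor (hg : g.IsOP β γ) (hf : f.IsOP α γ) (hr : f.ran ⊆ g.ran) :
    ∃ h : OrdMap.{u}, h.IsOP α β ∧ g.comp h = f := by
  have key : ∀ x, ∀ hx : (f x).Dom, ∃ z, (f x).get hx ∈ g z := fun x hx =>
    hr ⟨x, Part.get_mem hx⟩
  choose φ hφ using key
  let h : OrdMap.{u} := fun x => ⟨(f x).Dom, φ x⟩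
  have hmem : ∀ {x z}, z ∈ h x → ∃ y, y ∈ f x ∧ y ∈ g z := by
    rintro x z ⟨hx, rfl⟩
    exact ⟨_, Part.get_mem (o := f x) hx, hφ x hx⟩
  have hex : ∀ {x y}, y ∈ f x → ∃ z, z ∈ h x := fun {x y} hy => ⟨_, hy.1, rfl⟩
  refine ⟨h, of_mem (fun x => ⟨?_, fun hx => ?_⟩) ?_ ?_, PFun.ext fun x y => ⟨fun hy => ?_, fun hy => ?_⟩⟩
  · rintro ⟨z, hz⟩
    obtain ⟨y, hy, -⟩ := hmem hz
    exact hf.lt_dom hy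
  · obtain ⟨y, hy⟩ := hf.exists_mem hx
    exact hex hy
  · intro x z hz
    obtain ⟨y, -, hy⟩ := hmem hz
    exact hg.lt_dom hy
  · intro x x' z z' hz hz' hlt
    obtain ⟨y, hy, hyz⟩ := hmem hz
    obtain ⟨y', hy', hyz'⟩ := hmem hz'
    exact hg.lt_of_lt hyz hyz' (hf.strictMono _ _ _ _ hy hy' hlt)
  · obtain ⟨z, hz, hzy⟩ := mem_comp.1 hy
    obtain ⟨y', hy', hyz'⟩ := hmem hz
    rwa [Part.mem_unique hzy hyz']
  · obtain ⟨z, hz⟩ := hex hy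
    obtain ⟨y', hy', hyz'⟩ := hmem hz
    rw [Part.mem_unique hy hy']
    exact mem_comp.2 ⟨z, hz, hyz'⟩

/-- Increasing maps with the same range agree. -/
theorem eq_of_ran_eq (hf : f.IsOP α γ) (hg : g.IsOP β γ) (hr : f.ran = g.ran) :
    α = β ∧ f = g := by
  obtain ⟨h, hh, rfl⟩ := hg.exists_factor hf hr.subset
  obtain ⟨h', hh', he⟩ := hf.exists_factor hg hr.superset
  have hαβ : α = β := le_antisymm hh.le hh'.le
  subst hαβ
  refine ⟨rfl, ?_⟩
  have hid : h = idOn α := by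
    refine PFun.ext fun x y => ?_
    -- Cancelling `g` in `g ∘ h ∘ h' = g` gives `h (h' x) = x`. Neither map lowers a point, so `x ≤
    -- h' x ≤ h (h' x) = x`, and `h` fixes `x`.
    have h1 : ∀ {x y}, y ∈ h x → y = x := by
      intro x y hy
      obtain ⟨w, hw⟩ := hh'.exists_mem (hh.lt_dom hy)
      obtain ⟨v, hv⟩ := hg.exists_mem (hh.lt_dom hy)
      have hv' := hv
      rw [← he] at hv'
      obtain ⟨w', hw', hv'⟩ := mem_comp.1 hv'
      obtain ⟨z, hz, hv'⟩ := mem_comp.1 hv'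
      have : x = z := hg.injective hv hv'
      subst this
      have h2 := hh'.le_apply hw'
      have h3 := hh.le_apply hz
      have : w' = x := le_antisymm h3 h2
      subst this
      exact Part.mem_unique hy hz
    rw [mem_idOn]
    constructor
    · intro hy
      exact ⟨hh.lt_dom hy, (h1 hy).symm⟩
    · rintro ⟨hx, rfl⟩
      obtain ⟨w, hw⟩ := hh.exists_mem hx
      rwa [h1 hw] at hw
  rw [hid, hg.comp_idOn_of_le le_rfl]

end IsOP

theorem isOP_idOn (h : α ≤ β) : (idOn α).IsOP α β := by
  refine IsOP.of_mem (fun x => ?_) (fun x y hy => ?_) (fun x x' y y' hy hy' hlt => ?_)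
  · simp [mem_idOn]
  · obtain ⟨h1, rfl⟩ := mem_idOn.1 hy
    exact h1.trans_le h
  · obtain ⟨-, rfl⟩ := mem_idOn.1 hy
    obtain ⟨-, rfl⟩ := mem_idOn.1 hy'
    exact hlt

theorem idOn_comp_idOn (h : α ≤ β) : (idOn β).comp (idOn α) = idOn α :=
  (isOP_idOn le_rfl).idOn_comp h

end OrdMap

/-- A bounded set of ordinals is contained in its strict supremum. -/
theorem subset_Iio_ssup {a : Set Ordinal.{u}} (h : BddAbove a) : a ⊆ Iio (ssup a) := by
  refine csInf_mem (s := {ξ | a ⊆ Iio ξ}) ?_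
  obtain ⟨b, hb⟩ := h
  exact ⟨b + 1, fun x hx => Order.lt_add_one_iff.2 (hb hx)⟩

theorem ssup_le {a : Set Ordinal.{u}} {ξ : Ordinal.{u}} (h : a ⊆ Iio ξ) : ssup a ≤ ξ :=
  csInf_le' h

/-! ### Absorption in ordinal addition. -/

namespace Ordinal

/-- `δ` is absorbed on the left by `x` exactly when `δ * ω ≤ x`. If `τ < δ * ω`, then `τ ≤ δ * n`
for some `n`, so `τ + τ ≤ δ * (2n) < δ * ω`. -/
theorem add_eq_of_add_mul_two {δ τ : Ordinal.{u}} (h : δ + (τ + τ) = τ + τ) : δ + τ = τ := by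
  rw [add_eq_right_iff_mul_omega0_le] at h ⊢
  by_contra! hlt
  have : τ + τ < δ * ω := by
    obtain ⟨n, hn, hlt⟩ := (lt_mul_iff_of_isSuccLimit isSuccLimit_omega0).1 hlt
    obtain ⟨n, rfl⟩ := lt_omega0.1 hn
    have h1 : δ * n + δ * n = δ * (n + n : ℕ) := by
      rw [Nat.cast_add, mul_add]
    calc τ + τ ≤ δ * n + δ * n := add_le_add hlt.le hlt.le
      _ = δ * (n + n : ℕ) := h1
      _ < δ * ω := ?_
    refine mul_lt_mul_of_pos_left (natCast_lt_omega0 _) ?_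
    rw [pos_iff_ne_zero]
    rintro rfl
    simp at hlt
  exact this.not_ge h

/-- After cancelling the smaller of `σ`, `σ'` on the left, the difference is absorbed by `τ + τ`,
hence already by `τ`. -/
theorem add_right_cancel_of_add_mul_two {σ σ' τ : Ordinal.{u}}
    (h : σ + τ + τ = σ' + τ + τ) : σ + τ = σ' + τ := by
  wlog hle : σ ≤ σ' generalizing σ σ'
  · exact (this h.symm (le_of_not_ge hle)).symm
  rw [← Ordinal.add_sub_cancel_of_le hle] at h ⊢
  rw [add_assoc, add_assoc, add_assoc, add_left_cancel_iff] at h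
  rw [add_assoc, add_eq_of_add_mul_two h.symm]

end Ordinal

/-! ### Segments indexed by their sets of ordinals -/

/-- `b` is the immediate successor of `a` in `Θ`. -/
structure IsCov (Θ : Set Ordinal.{u}) (a b : Ordinal.{u}) : Prop where
  left : a ∈ Θ
  right : b ∈ Θ
  lt : a < b
  not_lt : ∀ c ∈ Θ, a < c → ¬ c < b

/-- `b` is a limit point of the order `Θ`. -/
structure IsLim (Θ : Set Ordinal.{u}) (b : Ordinal.{u}) : Prop where
  mem : b ∈ Θ
  exists_lt : ∃ a ∈ Θ, a < b
  between : ∀ a ∈ Θ, a < b → ∃ c ∈ Θ, a < c ∧ c < b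

theorem IsCov.le_of_lt {Θ : Set Ordinal.{u}} {a b m : Ordinal.{u}} (h : IsCov Θ m b) (ha : a ∈ Θ)
    (hab : a < b) : a ≤ m := by
  by_contra! hlt
  exact h.not_lt a ha hlt hab

theorem exists_isCov_of_not_isLim {Θ : Set Ordinal.{u}} {a b : Ordinal.{u}} (ha : a ∈ Θ)
    (hb : b ∈ Θ) (hab : a < b) (h : ¬ IsLim Θ b) : ∃ m, IsCov Θ m b := by
  by_contra! hm
  refine h ⟨hb, ⟨a, ha, hab⟩, fun c hc hcb => ?_⟩
  by_contra! hcon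
  exact hm c ⟨hc, hb, hcb, fun d hd hcd hdb => (hcon d hd hcd).not_gt hdb⟩

/-- A morass segment whose levels are indexed by the ordinals `θ_i` themselves, without the
requirement on the cofinalities of the limit levels. -/
structure IsSegment (κ : Cardinal.{u}) (Θ : Set Ordinal.{u})
    (F : Ordinal.{u} → Ordinal.{u} → Set OrdMap.{u}) : Prop where
  card_lt : #Θ < Cardinal.lift.{u + 1} κ
  lt_succ : ∀ a ∈ Θ, a < (Order.succ κ).ord
  supp : ∀ {a b f}, f ∈ F a b → a ∈ Θ ∧ b ∈ Θ ∧ a ≤ b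
  isOP : ∀ {a b f}, f ∈ F a b → f.IsOP a b
  maps_card_lt : ∀ a b, #(F a b) < Cardinal.lift.{u + 1} κ
  self : ∀ {a}, a ∈ Θ → F a a = {OrdMap.idOn a}
  cover : ∀ {a b}, IsCov Θ a b →
    (∃ f : OrdMap.{u}, F a b = {f} ∧ ssup f.ran < b) ∨ IsAlmostExactAmalgamationPair (F a b) a b
  directed : ∀ {k}, IsLim Θ k → ∀ {i₀ i₁ g₀ g₁}, i₀ < k → i₁ < k → g₀ ∈ F i₀ k → g₁ ∈ F i₁ k →
    ∃ j, i₀ ≤ j ∧ i₁ ≤ j ∧ j < k ∧ ∃ h ∈ F j k, ∃ g₀' ∈ F i₀ j, ∃ g₁' ∈ F i₁ j,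
      g₀ = h.comp g₀' ∧ g₁ = h.comp g₁'
  factor : ∀ {i j k}, i ≤ j → j ≤ k → j ∈ Θ → ∀ {h}, h ∈ F i k ↔
    ∃ f ∈ F i j, ∃ g ∈ F j k, h = g.comp f

/-- All limit levels have small cofinality. -/
def HasSmallCof (κ : Cardinal.{u}) (Θ : Set Ordinal.{u}) : Prop :=
  ∀ b, IsLim Θ b → b.cof < κ

/-- The morass part of the order of the forcing. -/
structure SegExt (Θ : Set Ordinal.{u}) (F : Ordinal.{u} → Ordinal.{u} → Set OrdMap.{u})
    (Θ' : Set Ordinal.{u}) (F' : Ordinal.{u} → Ordinal.{u} → Set OrdMap.{u}) : Prop where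
  levels : Θ ⊆ Θ'
  maps : ∀ a b, F a b ⊆ F' a b
  cover_eq : ∀ {a b}, IsCov Θ a b → IsCov Θ' a b → F a b = F' a b

theorem IsCov.of_subset {Θ Θ' : Set Ordinal.{u}} {a b : Ordinal.{u}} (h : IsCov Θ' a b)
    (hs : Θ ⊆ Θ') (ha : a ∈ Θ) (hb : b ∈ Θ) : IsCov Θ a b :=
  ⟨ha, hb, h.lt, fun c hc => h.not_lt c (hs hc)⟩

theorem SegExt.trans {Θ Θ' Θ'' : Set Ordinal.{u}}
    {F F' F'' : Ordinal.{u} → Ordinal.{u} → Set OrdMap.{u}}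
    (h : SegExt Θ F Θ' F') (h' : SegExt Θ' F' Θ'' F'') : SegExt Θ F Θ'' F'' :=
  ⟨h.levels.trans h'.levels, fun a b => (h.maps a b).trans (h'.maps a b), fun hc hc'' =>
    have hc' := hc''.of_subset h'.levels (h.levels hc.left) (h.levels hc.right)
    (h.cover_eq hc hc').trans (h'.cover_eq hc' hc'')⟩

/-- With `τ = a - σ` the length of the shifted tail, `h` carries the part of `a` above `σ` onto the
interval from `a` to `a + τ`. Only this arithmetic of the two levels is needed to study amalgamation
pairs along a chain. -/
theorem IsAlmostExactAmalgamationPair.exists_add {𝓕 : Set OrdMap.{u}} {a b : Ordinal.{u}}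
    (h : IsAlmostExactAmalgamationPair 𝓕 a b) : ∃ σ τ, a = σ + τ ∧ b = a + τ + 1 := by
  obtain ⟨h, -, -, hh, ⟨σ, hσ, hid, hsh⟩, ρ, hρ, rfl⟩ := h
  refine ⟨σ, a - σ, (Ordinal.add_sub_cancel_of_le hσ.le).symm, ?_⟩
  have ha := Ordinal.add_sub_cancel_of_le hσ.le
  set τ := a - σ
  suffices Iio ρ = Iio (a + τ) by rw [Iio_injective this]
  rw [← hρ]
  ext y
  simp only [mem_union, mem_Iio]
  constructor
  · rintro (hy | ⟨x, hx⟩)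
    · exact hy.trans_le le_self_add
    · rcases lt_or_ge x σ with hxσ | hxσ
      · rw [Part.mem_unique hx (hid x hxσ)]
        exact (hxσ.trans hσ).trans_le le_self_add
      · obtain ⟨ξ, rfl⟩ := exists_add_of_le hxσ
        have hlt : σ + ξ < a := hh.lt_dom hx
        rw [Part.mem_unique hx (hsh ξ hlt)]
        rw [← ha] at hlt
        exact add_lt_add_right (lt_of_add_lt_add_left hlt) a
  · intro hy
    rcases lt_or_ge y a with hya | hya
    · exact Or.inl hya
    · obtain ⟨ξ, rfl⟩ := exists_add_of_le hya
      refine Or.inr ⟨σ + ξ, hsh ξ ?_⟩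
      rw [← ha]
      exact add_lt_add_right (lt_of_add_lt_add_left hy) σ

theorem mk_iUnion_lt_lift {κ : Cardinal.{u}} (hκ : κ.IsRegular) {ι : Type u} (hι : #ι < κ)
    {α : Type (u + 1)} (s : ι → Set α) (hs : ∀ i, #(s i) < Cardinal.lift.{u + 1} κ) :
    #(⋃ i, s i : Set α) < Cardinal.lift.{u + 1} κ := by
  have h := mk_iUnion_le_sum_mk_lift (f := s)
  refine lt_of_le_of_lt ?_ (sum_lt_lift_of_isRegular.{u, u + 1} hκ.lift (by simpa using hι) hs)
  rwa [lift_id'.{u, u + 1}] at h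

/-! ### Unions of chains of segments. -/

section Union

variable {κ : Cardinal.{u}} {ι : Type u} [LinearOrder ι] {Θ : ι → Set Ordinal.{u}}
  {F : ι → Ordinal.{u} → Ordinal.{u} → Set OrdMap.{u}}

/-- The union of a chain of segments is a segment. -/
theorem IsSegment.iUnion (hκ : κ.IsRegular) (hι : #ι < κ) (hS : ∀ α, IsSegment κ (Θ α) (F α))
    (hext : ∀ α β, α ≤ β → SegExt (Θ α) (F α) (Θ β) (F β)) :
    IsSegment κ (⋃ α, Θ α) (fun a b => ⋃ α, F α a b) := by
  -- An immediate successor in the union is one at every late stage, and `cover_eq` then freezes the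
  -- set of maps between the two levels.
  have hcov : ∀ {a b}, IsCov (⋃ α, Θ α) a b → ∃ α, IsCov (Θ α) a b ∧ ⋃ β, F β a b = F α a b := by
    intro a b h
    obtain ⟨α, ha⟩ := mem_iUnion.1 h.left
    obtain ⟨β, hb⟩ := mem_iUnion.1 h.right
    have hγ : ∀ γ, max α β ≤ γ → IsCov (Θ γ) a b := fun γ hγ =>
      h.of_subset (subset_iUnion Θ γ) ((hext _ _ ((le_max_left _ _).trans hγ)).levels ha)
        ((hext _ _ ((le_max_right _ _).trans hγ)).levels hb)
    refine ⟨max α β, hγ _ le_rfl, subset_antisymm (iUnion_subset fun γ => ?_)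
      (subset_iUnion (fun γ => F γ a b) _)⟩
    rw [(hext _ _ (le_max_left (max α β) γ)).cover_eq (hγ _ le_rfl) (hγ _ (le_max_left _ _))]
    exact (hext _ _ (le_max_right _ _)).maps _ _
  refine ⟨mk_iUnion_lt_lift hκ hι Θ fun α => (hS α).card_lt, ?_, ?_, ?_,
    fun a b => mk_iUnion_lt_lift hκ hι _ fun α => (hS α).maps_card_lt a b, ?_, ?_, ?_, ?_⟩
  · intro a ha
    obtain ⟨α, ha⟩ := mem_iUnion.1 ha
    exact (hS α).lt_succ a ha
  · intro a b f hf
    obtain ⟨α, hf⟩ := mem_iUnion.1 hf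
    have := (hS α).supp hf
    exact ⟨mem_iUnion_of_mem α this.1, mem_iUnion_of_mem α this.2.1, this.2.2⟩
  · intro a b f hf
    obtain ⟨α, hf⟩ := mem_iUnion.1 hf
    exact (hS α).isOP hf
  · intro a ha
    obtain ⟨α, ha⟩ := mem_iUnion.1 ha
    refine subset_antisymm (iUnion_subset fun β => ?_) ?_
    · intro f hf
      rwa [← (hS β).self ((hS β).supp hf).1]
    · rw [← (hS α).self ha]
      exact subset_iUnion (fun β => F β a a) α
  · intro a b h
    obtain ⟨α, hα, he⟩ := hcov h
    rw [he]
    exact (hS α).cover hα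
  · intro b hb i₀ i₁ g₀ g₁ hi₀ hi₁ hg₀ hg₁
    obtain ⟨α₀, hg₀⟩ := mem_iUnion.1 hg₀
    obtain ⟨α₁, hg₁⟩ := mem_iUnion.1 hg₁
    let α := max α₀ α₁
    have hg₀ : ∀ β, α ≤ β → g₀ ∈ F β i₀ b := fun β h =>
      (hext _ _ ((le_max_left _ _).trans h)).maps _ _ hg₀
    have hg₁ : ∀ β, α ≤ β → g₁ ∈ F β i₁ b := fun β h =>
      (hext _ _ ((le_max_right _ _).trans h)).maps _ _ hg₁
    -- At such a stage directedness is available: by the hypothesis on limits, or because all maps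
    -- into `b` factor through the single map from its predecessor. The remaining case, a pair at
    -- every late stage, has to be excluded.
    have key : ∃ β, α ≤ β ∧ (IsLim (Θ β) b ∨ ∃ m f, IsCov (Θ β) m b ∧ F β m b = {f}) := by
      by_contra! hcon
      have hpair : ∀ β, α ≤ β → ∃ τ m σ, IsCov (Θ β) m b ∧ m = σ + τ ∧ b = m + τ + 1 := by
        intro β hβ
        obtain ⟨h1, h2⟩ := hcon β hβ
        have hs := (hS β).supp (hg₀ β hβ)
        obtain ⟨m, hm⟩ := exists_isCov_of_not_isLim hs.1 hs.2.1 hi₀ h1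
        rcases (hS β).cover hm with ⟨f, hf, -⟩ | hp
        · exact absurd hf (h2 m f hm)
        · obtain ⟨σ, τ, h⟩ := hp.exists_add
          exact ⟨τ, m, σ, hm, h⟩
      let T := {τ | ∃ β, α ≤ β ∧ ∃ m σ, IsCov (Θ β) m b ∧ m = σ + τ ∧ b = m + τ + 1}
      have hT : T.Nonempty := (hpair α le_rfl).imp fun τ h => ⟨α, le_rfl, h⟩
      obtain ⟨β, hβ, m, σ, hm, hmσ, hbm⟩ := csInf_mem hT
      -- At the stage with the shortest tail, the limit `b` still has a level `c` of the union above
      -- its predecessor `m`. At a stage containing `c` the predecessor is some `m' > m` with tail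
      -- `τ'`, and `m + τ = m' + τ'` because `b` has not moved. Minimality forces `τ' = τ`, and
      -- cancellation gives `m = m'`.
      obtain ⟨c, hc, hmc, hcb⟩ := hb.between m (mem_iUnion_of_mem β hm.left) hm.lt
      obtain ⟨γ, hc⟩ := mem_iUnion.1 hc
      have hβγ : α ≤ max β γ := hβ.trans (le_max_left _ _)
      obtain ⟨τ', m', σ', hm', hmσ', hbm'⟩ := hpair _ hβγ
      have hle : sInf T ≤ τ' := csInf_le' ⟨_, hβγ, m', σ', hm', hmσ', hbm'⟩
      have hmm : m < m' := hmc.trans_le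
        (hm'.le_of_lt ((hext _ _ (le_max_right β γ)).levels hc) hcb)
      have hsum : m + sInf T = m' + τ' := by
        have : m + sInf T + 1 = m' + τ' + 1 := hbm.symm.trans hbm'
        simpa using this
      have heq : sInf T = τ' := by
        refine hle.antisymm ?_
        by_contra! hlt
        have h1 : m + sInf T < m + τ' := add_lt_add_right hlt m
        exact (h1.trans_le (add_le_add_left hmm.le τ')).ne hsum
      refine hmm.ne ?_
      rw [← heq] at hsum hmσ'
      rw [hmσ, hmσ'] at hsum ⊢
      exact Ordinal.add_right_cancel_of_add_mul_two hsum
    obtain ⟨β, hβ, hl | ⟨m, f, hm, hf⟩⟩ := key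
    · obtain ⟨j, h0, h1, hj, h, hh, g₀', hg₀', g₁', hg₁', h⟩ :=
        (hS β).directed hl hi₀ hi₁ (hg₀ β hβ) (hg₁ β hβ)
      exact ⟨j, h0, h1, hj, _, mem_iUnion_of_mem β hh, _, mem_iUnion_of_mem β hg₀', _,
        mem_iUnion_of_mem β hg₁', h⟩
    · have h0 := hm.le_of_lt ((hS β).supp (hg₀ β hβ)).1 hi₀
      have h1 := hm.le_of_lt ((hS β).supp (hg₁ β hβ)).1 hi₁
      obtain ⟨g₀', hg₀', h₀, hh₀, he₀⟩ := ((hS β).factor h0 hm.lt.le hm.left).1 (hg₀ β hβ)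
      obtain ⟨g₁', hg₁', h₁, hh₁, he₁⟩ := ((hS β).factor h1 hm.lt.le hm.left).1 (hg₁ β hβ)
      have hh := hh₀
      rw [hf, mem_singleton_iff] at hh₀ hh₁
      subst hh₀ hh₁
      exact ⟨m, h0, h1, hm.lt, _, mem_iUnion_of_mem β hh, _, mem_iUnion_of_mem β hg₀', _,
        mem_iUnion_of_mem β hg₁', he₀, he₁⟩
  · intro i j k hij hjk hj h
    obtain ⟨δ, hj⟩ := mem_iUnion.1 hj
    constructor
    · intro hh
      obtain ⟨α, hh⟩ := mem_iUnion.1 hh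
      obtain ⟨f, hf, g, hg, he⟩ := ((hS (max α δ)).factor hij hjk
        ((hext _ _ (le_max_right _ _)).levels hj)).1 ((hext _ _ (le_max_left _ _)).maps _ _ hh)
      exact ⟨f, mem_iUnion_of_mem _ hf, g, mem_iUnion_of_mem _ hg, he⟩
    · rintro ⟨f, hf, g, hg, he⟩
      obtain ⟨α, hf⟩ := mem_iUnion.1 hf
      obtain ⟨β, hg⟩ := mem_iUnion.1 hg
      refine mem_iUnion_of_mem (max α β) (((hS _).factor hij hjk ?_).2
        ⟨f, (hext _ _ (le_max_left _ _)).maps _ _ hf, g, (hext _ _ (le_max_right _ _)).maps _ _ hg,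
          he⟩)
      exact (hext _ _ (le_max_left _ _)).levels ((hS α).supp hf).2.1

/-- The stages of a chain of segments are extended by the union. -/
theorem SegExt.iUnion (hext : ∀ α β, α ≤ β → SegExt (Θ α) (F α) (Θ β) (F β)) (α : ι) :
    SegExt (Θ α) (F α) (⋃ α, Θ α) (fun a b => ⋃ α, F α a b) := by
  refine ⟨subset_iUnion Θ α, fun a b => subset_iUnion (fun α => F α a b) α, fun {a b} h h' =>
    subset_antisymm (subset_iUnion (fun α => F α a b) α) (iUnion_subset fun β => ?_)⟩
  have hm := hext _ _ (le_max_left α β)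
  rw [hm.cover_eq h (h'.of_subset (subset_iUnion Θ _) (hm.levels h.left) (hm.levels h.right))]
  exact (hext _ _ (le_max_right α β)).maps _ _

/-- Limit levels have small cofinality, so `b` is either the least level or has a predecessor `m`.
An amalgamation pair would make `b` a successor ordinal, of cofinality 1. Hence a single map with
range bounded below `b` leads from `m` to `b`, and all maps from lower levels into `b` factor
through it. -/
theorem IsSegment.exists_bound (hκ : κ.IsRegular) {Θ : Set Ordinal.{u}}
    {F : Ordinal.{u} → Ordinal.{u} → Set OrdMap.{u}} (hS : IsSegment κ Θ F)
    (hc : HasSmallCof κ Θ) {b : Ordinal.{u}} (hb : b ∈ Θ) (hb0 : 0 < b) (hcof : ¬ b.cof < κ) :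
    ∃ B < b, ∀ a ∈ Θ, a < b → a ≤ B ∧ ∀ g ∈ F a b, g.ran ⊆ Iio B := by
  by_cases hex : ∃ a ∈ Θ, a < b
  · obtain ⟨a, ha, hab⟩ := hex
    obtain ⟨m, hm⟩ := exists_isCov_of_not_isLim ha hb hab fun h => hcof (hc b h)
    rcases hS.cover hm with ⟨f, hf, hlt⟩ | hp
    · refine ⟨max m (ssup f.ran), max_lt hm.lt hlt, fun a ha hab =>
        ⟨(hm.le_of_lt ha hab).trans (le_max_left _ _), fun g hg y hy => ?_⟩⟩
      obtain ⟨g', hg', f', hf', rfl⟩ := (hS.factor (hm.le_of_lt ha hab) hm.lt.le hm.left).1 hg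
      have hf'' := hf'
      rw [hf, mem_singleton_iff] at hf'
      subst hf'
      obtain ⟨x, hx⟩ := hy
      obtain ⟨z, -, hz⟩ := OrdMap.mem_comp.1 hx
      have hbd : BddAbove f'.ran := ⟨b, by
        rintro y ⟨x, hx⟩
        exact ((hS.isOP hf'').lt x y hx).le⟩
      exact (mem_Iio.1 (subset_Iio_ssup hbd ⟨z, hz⟩)).trans_le (le_max_right _ _)
    · obtain ⟨σ, τ, -, h⟩ := hp.exists_add
      refine absurd ?_ hcof
      rw [h, Ordinal.cof_add_one]
      exact_mod_cast hκ.nat_lt 1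
  · push Not at hex
    exact ⟨0, hb0, fun a ha hab => absurd hab (hex a ha).not_gt⟩

/-- Each stage bounds its own levels and maps below `b`; there are fewer than `κ ≤ cof b` stages, so
the supremum of the bounds stays below `b`. -/
theorem exists_bound_iUnion (hκ : κ.IsRegular) (hι : #ι < κ)
    (hS : ∀ α, IsSegment κ (Θ α) (F α)) (hc : ∀ α, HasSmallCof κ (Θ α))
    (hext : ∀ α β, α ≤ β → SegExt (Θ α) (F α) (Θ β) (F β)) {b : Ordinal.{u}}
    (hb : IsLim (⋃ α, Θ α) b) (hcof : ¬ b.cof < κ) :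
    ∃ ν < b, ν.cof < κ ∧ ∀ a ∈ ⋃ α, Θ α, a < b → a < ν ∧ ∀ g ∈ ⋃ α, F α a b, g.ran ⊆ Iio ν := by
  have hb0 : 0 < b := by
    obtain ⟨a, -, ha⟩ := hb.exists_lt
    exact (zero_le (a := a)).trans_lt ha
  have hstage : ∀ α, ∃ B < b, b ∈ Θ α → ∀ a ∈ Θ α, a < b → a ≤ B ∧ ∀ g ∈ F α a b,
      g.ran ⊆ Iio B := by
    intro α
    by_cases h : b ∈ Θ α
    · obtain ⟨B, hB, h'⟩ := (hS α).exists_bound hκ (hc α) h hb0 hcof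
      exact ⟨B, hB, fun _ => h'⟩
    · exact ⟨0, hb0, fun h' => absurd h' h⟩
  choose B hB hBa using hstage
  have hlt : ⨆ α, B α < b := Ordinal.iSup_lt_of_lt_cof (hι.trans_le (not_lt.1 hcof)) hB
  have hone : (1 : Cardinal.{u}) < κ := by exact_mod_cast hκ.nat_lt 1
  -- The `+ 1` makes the new level strictly larger than the old ones and gives it cofinality 1. It
  -- remains below `b`, which is not a successor since its cofinality is at least `κ`.
  refine ⟨(⨆ α, B α) + 1, lt_of_le_of_ne (Order.add_one_le_of_lt hlt) ?_, ?_, fun a ha hab =>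
    ⟨?_, fun g hg => ?_⟩⟩
  · rintro rfl
    rw [Ordinal.cof_add_one] at hcof
    exact hcof hone
  · rwa [Ordinal.cof_add_one]
  · obtain ⟨α, ha⟩ := mem_iUnion.1 ha
    obtain ⟨β, hβ⟩ := mem_iUnion.1 hb.mem
    refine Order.lt_add_one_iff.2 (le_trans ?_ (Ordinal.le_iSup B (max α β)))
    exact (hBa _ ((hext _ _ (le_max_right _ _)).levels hβ) a
      ((hext _ _ (le_max_left _ _)).levels ha) hab).1
  · obtain ⟨α, hg⟩ := mem_iUnion.1 hg
    have hs := (hS α).supp hg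
    refine ((hBa α hs.2.1 a hs.1 hab).2 g hg).trans (Iio_subset_Iio ?_)
    exact (Ordinal.le_iSup B α).trans (Order.le_succ _)

end Union

/-! ### Inserting levels below the limit levels of large cofinality -/

section Insert

/-- The least element of `Θ` above `x`. -/
noncomputable def levelCeil (Θ : Set Ordinal.{u}) (x : Ordinal.{u}) : Ordinal.{u} :=
  sInf {y ∈ Θ | x ≤ y}

/-- `Θ` with a new level `ν b` for each limit level `b` of large cofinality. -/
def insertLevels (κ : Cardinal.{u}) (Θ : Set Ordinal.{u}) (ν : Ordinal.{u} → Ordinal.{u}) :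
    Set Ordinal.{u} :=
  Θ ∪ ν '' {b | IsLim Θ b ∧ ¬ b.cof < κ}

/-- The maps between the levels of `insertLevels`: restrictions of the given ones. -/
def insertMaps (κ : Cardinal.{u}) (Θ : Set Ordinal.{u})
    (F : Ordinal.{u} → Ordinal.{u} → Set OrdMap.{u}) (ν : Ordinal.{u} → Ordinal.{u})
    (x y : Ordinal.{u}) : Set OrdMap.{u} :=
  {f | x ∈ insertLevels κ Θ ν ∧ y ∈ insertLevels κ Θ ν ∧ x ≤ y ∧
    ∃ g ∈ F (levelCeil Θ x) (levelCeil Θ y), f = g.comp (OrdMap.idOn x)}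

/-- `ν` bounds, below each limit level of large cofinality, all the earlier levels and maps. -/
def IsBounding (κ : Cardinal.{u}) (Θ : Set Ordinal.{u})
    (F : Ordinal.{u} → Ordinal.{u} → Set OrdMap.{u}) (ν : Ordinal.{u} → Ordinal.{u}) : Prop :=
  ∀ b, IsLim Θ b → ¬ b.cof < κ → ν b < b ∧ (ν b).cof < κ ∧
    ∀ a ∈ Θ, a < b → a < ν b ∧ ∀ g ∈ F a b, g.ran ⊆ Iio (ν b)

variable {κ : Cardinal.{u}} {Θ : Set Ordinal.{u}}
  {F : Ordinal.{u} → Ordinal.{u} → Set OrdMap.{u}} {ν : Ordinal.{u} → Ordinal.{u}}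
  {x y a b : Ordinal.{u}}

theorem levelCeil_of_mem (h : x ∈ Θ) : levelCeil Θ x = x :=
  le_antisymm (csInf_le' ⟨h, le_rfl⟩) (le_csInf ⟨x, h, le_rfl⟩ fun _ hy => hy.2)

theorem levelCeil_le (ha : a ∈ Θ) (hxa : x ≤ a) : levelCeil Θ x ≤ a :=
  csInf_le' ⟨ha, hxa⟩

theorem lt_of_lt_levelCeil (ha : a ∈ Θ) (h : a < levelCeil Θ x) : a < x := by
  by_contra! hle
  exact (levelCeil_le ha hle).not_gt h

theorem subset_insertLevels : Θ ⊆ insertLevels κ Θ ν := subset_union_left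

theorem IsBounding.levelCeil_eq (hν : IsBounding κ Θ F ν) (hb : IsLim Θ b) (hc : ¬ b.cof < κ) :
    levelCeil Θ (ν b) = b := by
  obtain ⟨h1, -, h3⟩ := hν b hb hc
  refine le_antisymm (levelCeil_le hb.mem h1.le) (le_csInf ⟨b, hb.mem, h1.le⟩ fun a ha => ?_)
  by_contra! hlt
  exact (h3 a ha.1 hlt).1.not_ge ha.2

/-- Old levels are their own ceilings, new ones lie below theirs. -/
theorem IsBounding.cases (hν : IsBounding κ Θ F ν) (hx : x ∈ insertLevels κ Θ ν) :
    (x ∈ Θ ∧ levelCeil Θ x = x) ∨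
      (IsLim Θ (levelCeil Θ x) ∧ ¬ (levelCeil Θ x).cof < κ ∧ x = ν (levelCeil Θ x) ∧
        x < levelCeil Θ x) := by
  rcases hx with hx | ⟨b, ⟨hb, hc⟩, rfl⟩
  · exact Or.inl ⟨hx, levelCeil_of_mem hx⟩
  · rw [hν.levelCeil_eq hb hc]
    exact Or.inr ⟨hb, hc, rfl, (hν b hb hc).1⟩

theorem IsBounding.levelCeil_mem (hν : IsBounding κ Θ F ν) (hx : x ∈ insertLevels κ Θ ν) :
    levelCeil Θ x ∈ Θ := by
  rcases hν.cases hx with ⟨h, he⟩ | ⟨h, -⟩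
  · rwa [he]
  · exact h.mem

theorem IsBounding.le_levelCeil (hν : IsBounding κ Θ F ν) (hx : x ∈ insertLevels κ Θ ν) :
    x ≤ levelCeil Θ x := by
  rcases hν.cases hx with ⟨-, he⟩ | ⟨-, -, -, h⟩
  · exact he.ge
  · exact h.le

theorem IsBounding.levelCeil_mono (hν : IsBounding κ Θ F ν) (hy : y ∈ insertLevels κ Θ ν)
    (h : x ≤ y) : levelCeil Θ x ≤ levelCeil Θ y :=
  levelCeil_le (hν.levelCeil_mem hy) (h.trans (hν.le_levelCeil hy))

/-- Two levels with the same ceiling: the upper one is old, the lower one new. -/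
theorem IsBounding.of_levelCeil_eq (hν : IsBounding κ Θ F ν) (hx : x ∈ insertLevels κ Θ ν)
    (hy : y ∈ insertLevels κ Θ ν) (h : x < y) (he : levelCeil Θ x = levelCeil Θ y) :
    y ∈ Θ ∧ IsLim Θ y ∧ ¬ y.cof < κ ∧ x = ν y := by
  have hxlt : x < levelCeil Θ x := he ▸ h.trans_le (hν.le_levelCeil hy)
  rcases hν.cases hx with ⟨-, h1⟩ | ⟨h1, h2, h3, -⟩
  · exact absurd h1 hxlt.ne'
  · rcases hν.cases hy with ⟨h4, h5⟩ | ⟨-, -, h4, -⟩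
    · rw [he, h5] at h1 h2 h3
      exact ⟨h4, h1, h2, h3⟩
    · rw [he] at h3
      exact absurd (h3.trans h4.symm) h.ne

/-- Old levels are their own ceilings, and restricting a map to its full domain does nothing. So the
insertion leaves the old segment intact. -/
theorem insertMaps_eq (hS : IsSegment κ Θ F) (ha : a ∈ Θ) (hb : b ∈ Θ) :
    insertMaps κ Θ F ν a b = F a b := by
  ext f
  simp only [insertMaps, mem_ofPred_eq, levelCeil_of_mem ha, levelCeil_of_mem hb]
  constructor
  · rintro ⟨-, -, -, g, hg, rfl⟩
    rwa [(hS.isOP hg).comp_idOn_of_le le_rfl]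
  · intro hf
    exact ⟨subset_insertLevels ha, subset_insertLevels hb, (hS.supp hf).2.2, f, hf,
      ((hS.isOP hf).comp_idOn_of_le le_rfl).symm⟩

theorem IsSegment.eq_idOn (hS : IsSegment κ Θ F) {f : OrdMap.{u}} (hf : f ∈ F a a) :
    f = OrdMap.idOn a := by
  rwa [hS.self (hS.supp hf).1] at hf

/-- When the target is a new level, the restricted map was only known to land below the ceiling; the
bounding hypothesis pushes its range below the new level. If both ceilings agree, the map is an
identity. -/
theorem insertMaps_isOP (hS : IsSegment κ Θ F) (hν : IsBounding κ Θ F ν) {f : OrdMap.{u}}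
    (hf : f ∈ insertMaps κ Θ F ν x y) : f.IsOP x y := by
  obtain ⟨hx, hy, hxy, g, hg, rfl⟩ := hf
  rcases (hν.levelCeil_mono hy hxy).eq_or_lt with he | hlt
  · rw [he] at hg
    rw [hS.eq_idOn hg, OrdMap.idOn_comp_idOn (hxy.trans (hν.le_levelCeil hy))]
    exact OrdMap.isOP_idOn hxy
  · have hop := (hS.isOP hg).restrict (hν.le_levelCeil hx)
    rcases hν.cases hy with ⟨-, he⟩ | ⟨h1, h2, h3, -⟩
    · rwa [he] at hop
    · refine ⟨hop.dom, fun u v hv => ?_, hop.strictMono⟩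
      have := ((hν _ h1 h2).2.2 _ (hν.levelCeil_mem hx) hlt).2 g hg
        ⟨u, (OrdMap.mem_comp_idOn.1 hv).2⟩
      rwa [← h3] at this

/-- Taking ceilings identifies distinct levels only in the pairs `ν y < y`, which the hypothesis on
`y` excludes. -/
theorem IsBounding.levelCeil_lt (hν : IsBounding κ Θ F ν) (hx : x ∈ insertLevels κ Θ ν)
    (hy : y ∈ insertLevels κ Θ ν) (hxy : x < y) (h : ¬ (IsLim Θ y ∧ ¬ y.cof < κ)) :
    levelCeil Θ x < levelCeil Θ y := by
  refine (hν.levelCeil_mono hy hxy.le).lt_of_ne fun he => h ?_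
  have := hν.of_levelCeil_eq hx hy hxy he
  exact ⟨this.2.1, this.2.2.1⟩

/-- A limit level of large cofinality is a successor in `insertLevels`. -/
theorem IsBounding.isCov (hν : IsBounding κ Θ F ν) (hb : IsLim Θ b) (hc : ¬ b.cof < κ) :
    IsCov (insertLevels κ Θ ν) (ν b) b := by
  obtain ⟨h1, -, h3⟩ := hν b hb hc
  refine ⟨Or.inr ⟨b, ⟨hb, hc⟩, rfl⟩, subset_insertLevels hb.mem, h1, fun c hcm h4 h5 => ?_⟩
  rcases (levelCeil_le hb.mem h5.le).eq_or_lt with he | hlt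
  · have := hν.of_levelCeil_eq hcm (subset_insertLevels hb.mem) h5
      (he.trans (levelCeil_of_mem hb.mem).symm)
    exact h4.ne' this.2.2.2
  · exact ((hν.le_levelCeil hcm).trans_lt (h3 _ (hν.levelCeil_mem hcm) hlt).1).not_gt h4

theorem IsCov.not_isLim (h : IsCov Θ a b) : ¬ IsLim Θ b := fun hl => by
  obtain ⟨c, hc, h1, h2⟩ := hl.between a h.left h.lt
  exact h.not_lt c hc h1 h2

/-- The limit levels after the insertion. -/
theorem IsBounding.of_isLim (hν : IsBounding κ Θ F ν) (hy : IsLim (insertLevels κ Θ ν) y) :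
    IsLim Θ (levelCeil Θ y) ∧ (∀ x ∈ insertLevels κ Θ ν, x < y → levelCeil Θ x < levelCeil Θ y) ∧
      y.cof < κ := by
  have hbad : ¬ (IsLim Θ y ∧ ¬ y.cof < κ) := fun h => (hν.isCov h.1 h.2).not_isLim hy
  have hlt := fun x hx hxy => hν.levelCeil_lt (x := x) hx hy.mem hxy hbad
  rcases hν.cases hy.mem with ⟨h1, h2⟩ | ⟨h1, h2, h3, -⟩
  · rw [h2] at hlt ⊢
    have hlim : IsLim Θ y := by
      obtain ⟨a, ha, hay⟩ := hy.exists_lt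
      refine ⟨h1, ⟨_, hν.levelCeil_mem ha, hlt a ha hay⟩, fun a ha hay => ?_⟩
      obtain ⟨c, hc, hac, hcy⟩ := hy.between a (subset_insertLevels ha) hay
      exact ⟨_, hν.levelCeil_mem hc, hac.trans_le (hν.le_levelCeil hc), hlt c hc hcy⟩
    exact ⟨hlim, hlt, by_contra fun hc => hbad ⟨hlim, hc⟩⟩
  · refine ⟨h1, hlt, ?_⟩
    rw [h3]
    exact (hν _ h1 h2).2.1

/-- All properties are pulled back along `levelCeil`. The only new pairs of consecutive levels are
`ν b < b`, whose single map is the identity, with strict supremum at most `ν b < b`. At a limit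
level, ceilings below it remain strictly smaller, so directedness can be taken from `F`. -/
theorem IsBounding.isSegment (hκ : κ.IsRegular) (hS : IsSegment κ Θ F)
    (hν : IsBounding κ Θ F ν) :
    IsSegment κ (insertLevels κ Θ ν) (insertMaps κ Θ F ν) := by
  refine ⟨?_, ?_, fun {a b f} h => ⟨h.1, h.2.1, h.2.2.1⟩, insertMaps_isOP hS hν, ?_, ?_, ?_, ?_, ?_⟩
  · refine (mk_union_le _ _).trans_lt (add_lt_of_lt hκ.lift.aleph0_le hS.card_lt
      ((mk_image_le.trans (mk_le_mk_of_subset ?_)).trans_lt hS.card_lt))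
    exact fun b hb => hb.1.mem
  · intro a ha
    exact (hν.le_levelCeil ha).trans_lt (hS.lt_succ _ (hν.levelCeil_mem ha))
  · intro a b
    refine (mk_le_mk_of_subset (t := (fun g : OrdMap.{u} => g.comp (OrdMap.idOn a)) ''
      F (levelCeil Θ a) (levelCeil Θ b)) ?_).trans_lt (mk_image_le.trans_lt (hS.maps_card_lt _ _))
    rintro f ⟨-, -, -, g, hg, rfl⟩
    exact ⟨g, hg, rfl⟩
  · intro a ha
    ext f
    simp only [insertMaps, mem_ofPred_eq, ha, le_refl, true_and, hS.self (hν.levelCeil_mem ha),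
      mem_singleton_iff, exists_eq_left, OrdMap.idOn_comp_idOn (hν.le_levelCeil ha)]
  · intro x y h
    by_cases hbad : IsLim Θ y ∧ ¬ y.cof < κ
    · have hx : x = ν y := by
        have hc := hν.isCov hbad.1 hbad.2
        exact le_antisymm (hc.le_of_lt h.left h.lt) (h.le_of_lt hc.left hc.lt)
      subst hx
      refine Or.inl ⟨OrdMap.idOn (ν y), ?_, ?_⟩
      · ext f
        simp only [insertMaps, mem_ofPred_eq, h.left, h.right, h.lt.le, true_and,
          hν.levelCeil_eq hbad.1 hbad.2, levelCeil_of_mem hbad.1.mem, hS.self hbad.1.mem,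
          mem_singleton_iff, exists_eq_left, OrdMap.idOn_comp_idOn h.lt.le]
      · refine (ssup_le ?_).trans_lt h.lt
        rintro z ⟨w, hw⟩
        exact (OrdMap.isOP_idOn le_rfl).lt w z hw
    · have hlt := hν.levelCeil_lt h.left h.right h.lt hbad
      -- A new level has no immediate predecessor: its ceiling is a limit of `Θ`, so old levels
      -- occur above any smaller ceiling, and they all lie below the new level.
      have hy : y ∈ Θ := by
        rcases hν.cases h.right with ⟨hy, -⟩ | ⟨h1, h2, h3, -⟩
        · exact hy
        · obtain ⟨c, hc, hxc, hcy⟩ := h1.between _ (hν.levelCeil_mem h.left) hlt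
          exact absurd (lt_of_lt_levelCeil hc hcy) (h.not_lt c (subset_insertLevels hc)
            ((hν.le_levelCeil h.left).trans_lt hxc))
      have hx : x ∈ Θ := by
        rw [levelCeil_of_mem hy] at hlt
        have : levelCeil Θ x = x := (h.le_of_lt (subset_insertLevels
          (hν.levelCeil_mem h.left)) hlt).antisymm (hν.le_levelCeil h.left)
        rw [← this]
        exact hν.levelCeil_mem h.left
      rw [insertMaps_eq hS hx hy]
      exact hS.cover (h.of_subset subset_insertLevels hx hy)
  · intro y hy i₀ i₁ g₀ g₁ hi₀ hi₁ hg₀ hg₁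
    obtain ⟨hlim, hlt, -⟩ := hν.of_isLim hy
    obtain ⟨hm₀, -, -, f₀, hf₀, rfl⟩ := hg₀
    obtain ⟨hm₁, -, -, f₁, hf₁, rfl⟩ := hg₁
    obtain ⟨j, h0, h1, hj, h, hh, f₀', hf₀', f₁', hf₁', rfl, rfl⟩ :=
      hS.directed hlim (hlt _ hm₀ hi₀) (hlt _ hm₁ hi₁) hf₀ hf₁
    have hjm := (hS.supp hh).1
    have hjy := lt_of_lt_levelCeil hjm hj
    refine ⟨j, (hν.le_levelCeil hm₀).trans h0, (hν.le_levelCeil hm₁).trans h1, hjy, h, ?_,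
      f₀'.comp (OrdMap.idOn i₀), ?_, f₁'.comp (OrdMap.idOn i₁), ?_, PFun.comp_assoc _ _ _,
      PFun.comp_assoc _ _ _⟩
    · refine ⟨subset_insertLevels hjm, hy.mem, hjy.le, h, ?_,
        ((hS.isOP hh).comp_idOn_of_le le_rfl).symm⟩
      rwa [levelCeil_of_mem hjm]
    · refine ⟨hm₀, subset_insertLevels hjm, (hν.le_levelCeil hm₀).trans h0, f₀', ?_, rfl⟩
      rwa [levelCeil_of_mem hjm]
    · refine ⟨hm₁, subset_insertLevels hjm, (hν.le_levelCeil hm₁).trans h1, f₁', ?_, rfl⟩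
      rwa [levelCeil_of_mem hjm]
  · intro i j k hij hjk hj h
    -- Restricting the outer map to `j` does no harm, since the restricted inner map already takes
    -- its values below `j`.
    have key : ∀ f ∈ F (levelCeil Θ i) (levelCeil Θ j), i ∈ insertLevels κ Θ ν →
        ∀ g : OrdMap.{u}, (g.comp (OrdMap.idOn j)).comp (f.comp (OrdMap.idOn i)) =
          (g.comp f).comp (OrdMap.idOn i) := by
      intro f hf hi g
      rw [PFun.comp_assoc, (insertMaps_isOP hS hν ⟨hi, hj, hij, f, hf, rfl⟩).idOn_comp le_rfl,
        PFun.comp_assoc]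
    constructor
    · rintro ⟨hi, hk, hik, g, hg, rfl⟩
      obtain ⟨f', hf', g', hg', rfl⟩ := (hS.factor (hν.levelCeil_mono hj hij)
        (hν.levelCeil_mono hk hjk) (hν.levelCeil_mem hj)).1 hg
      exact ⟨_, ⟨hi, hj, hij, f', hf', rfl⟩, _, ⟨hj, hk, hjk, g', hg', rfl⟩, (key f' hf' hi g').symm⟩
    · rintro ⟨f, ⟨hi, -, -, f', hf', rfl⟩, g, ⟨-, hk, -, g', hg', rfl⟩, rfl⟩
      exact ⟨hi, hk, hij.trans hjk, g'.comp f', (hS.factor (hν.levelCeil_mono hj hij)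
        (hν.levelCeil_mono hk hjk) (hν.levelCeil_mem hj)).2 ⟨f', hf', g', hg', rfl⟩, key f' hf' hi g'⟩

theorem IsBounding.segExt (hS : IsSegment κ Θ F) :
    SegExt Θ F (insertLevels κ Θ ν) (insertMaps κ Θ F ν) := by
  refine ⟨subset_insertLevels, fun a b f hf => ?_, fun {a b} h _ =>
    (insertMaps_eq hS h.left h.right).symm⟩
  have := hS.supp hf
  rwa [insertMaps_eq hS this.1 this.2.1]

theorem IsBounding.hasSmallCof (hν : IsBounding κ Θ F ν) :
    HasSmallCof κ (insertLevels κ Θ ν) := fun _ hb => (hν.of_isLim hb).2.2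

end Insert

/-! ### Adding a top level -/

section AddTop

/-- The maps of the segment obtained by adding a new top level `τ` above the level `t`, with the
single map `h` from `t` to `τ`. -/
def addTopMaps (F : Ordinal.{u} → Ordinal.{u} → Set OrdMap.{u}) (t τ : Ordinal.{u})
    (h : OrdMap.{u}) (a b : Ordinal.{u}) : Set OrdMap.{u} :=
  F a b ∪ {f | b = τ ∧ ((a = τ ∧ f = OrdMap.idOn τ) ∨ ∃ g ∈ F a t, f = h.comp g)}

variable {κ : Cardinal.{u}} {Θ : Set Ordinal.{u}}
  {F : Ordinal.{u} → Ordinal.{u} → Set OrdMap.{u}} {t τ a b : Ordinal.{u}} {h : OrdMap.{u}}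

theorem addTopMaps_of_ne (hb : b ≠ τ) : addTopMaps F t τ h a b = F a b := by
  simp [addTopMaps, hb]

theorem IsSegment.addTopMaps_self (hS : IsSegment κ Θ F) (hτ : ∀ a ∈ Θ, a < τ) :
    addTopMaps F t τ h τ τ = {OrdMap.idOn τ} := by
  have hn : ∀ b f, f ∉ F τ b := fun b f hf => (hτ _ (hS.supp hf).1).false
  ext f
  simp [addTopMaps, hn]

theorem IsSegment.mem_addTopMaps_top (hS : IsSegment κ Θ F) (hτ : ∀ a ∈ Θ, a < τ) (ha : a ∈ Θ)
    {f : OrdMap.{u}} : f ∈ addTopMaps F t τ h a τ ↔ ∃ g ∈ F a t, f = h.comp g := by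
  have hn : ∀ f, f ∉ F a τ := fun f hf => (hτ _ (hS.supp hf).2.1).false
  simp [addTopMaps, hn, (hτ a ha).ne]

/-- The new top has `t` as immediate predecessor, so adding it creates no limit level. -/
theorem IsLim.of_insert_top (hτ : ∀ a ∈ Θ, a < τ) (ht : t ∈ Θ) (hm : ∀ a ∈ Θ, a ≤ t)
    (hb : IsLim (insert τ Θ) b) : IsLim Θ b := by
  have hbΘ : b ∈ Θ := by
    refine (mem_insert_iff.1 hb.mem).resolve_left ?_
    rintro rfl
    obtain ⟨c, hc, h1, h2⟩ := hb.between t (mem_insert_of_mem _ ht) (hτ t ht)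
    rcases mem_insert_iff.1 hc with rfl | hc
    · exact h2.false
    · exact (hm c hc).not_gt h1
  have hin : ∀ c ∈ insert τ Θ, c < b → c ∈ Θ := by
    intro c hc hcb
    refine (mem_insert_iff.1 hc).resolve_left ?_
    rintro rfl
    exact hcb.not_gt (hτ b hbΘ)
  obtain ⟨a, ha, hab⟩ := hb.exists_lt
  refine ⟨hbΘ, ⟨a, hin a ha hab, hab⟩, fun a ha hab => ?_⟩
  obtain ⟨c, hc, h1, h2⟩ := hb.between a (mem_insert_of_mem _ ha) hab
  exact ⟨c, hin c hc h2, h1, h2⟩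

theorem HasSmallCof.insert_top (hc : HasSmallCof κ Θ) (hτ : ∀ a ∈ Θ, a < τ) (ht : t ∈ Θ)
    (hm : ∀ a ∈ Θ, a ≤ t) : HasSmallCof κ (insert τ Θ) := fun b hb =>
  hc b (hb.of_insert_top hτ ht hm)

/-- The one new pair of consecutive levels is `t < τ`. Its only map `h` has range inside `o < τ`,
which gives the singleton alternative. Maps from lower levels into `τ` are by definition those that
factor through `h`. -/
theorem IsSegment.addTop (hκ : κ.IsRegular) (hS : IsSegment κ Θ F) (hτ : ∀ a ∈ Θ, a < τ)
    (ht : t ∈ Θ) (hm : ∀ a ∈ Θ, a ≤ t) (hτκ : τ < (Order.succ κ).ord) {o : Ordinal.{u}}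
    (ho : o < τ) (hh : h.IsOP t o) : IsSegment κ (insert τ Θ) (addTopMaps F t τ h) := by
  have hone : (1 : Cardinal.{u + 1}) < Cardinal.lift.{u + 1} κ := by
    exact_mod_cast hκ.lift.nat_lt 1
  have hopt : h.IsOP t τ := hh.mono ho.le
  have hsupp : ∀ {a b f}, f ∈ addTopMaps F t τ h a b →
      a ∈ insert τ Θ ∧ b ∈ insert τ Θ ∧ a ≤ b := by
    rintro a b f (hf | ⟨rfl, ⟨rfl, -⟩ | ⟨g, hg, -⟩⟩)
    · have := hS.supp hf
      exact ⟨mem_insert_of_mem _ this.1, mem_insert_of_mem _ this.2.1, this.2.2⟩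
    · exact ⟨mem_insert _ _, mem_insert _ _, le_rfl⟩
    · have := (hS.supp hg).1
      exact ⟨mem_insert_of_mem _ this, mem_insert _ _, (hτ a this).le⟩
  have hisOP : ∀ {a b f}, f ∈ addTopMaps F t τ h a b → f.IsOP a b := by
    rintro a b f (hf | ⟨rfl, ⟨rfl, rfl⟩ | ⟨g, hg, rfl⟩⟩)
    · exact hS.isOP hf
    · exact OrdMap.isOP_idOn le_rfl
    · exact hopt.comp (hS.isOP hg)
  have hself : ∀ {a}, a ∈ insert τ Θ → addTopMaps F t τ h a a = {OrdMap.idOn a} := by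
    intro a ha
    rcases mem_insert_iff.1 ha with rfl | ha
    · exact hS.addTopMaps_self hτ
    · rw [addTopMaps_of_ne (hτ a ha).ne, hS.self ha]
  refine ⟨?_, ?_, hsupp, hisOP, ?_, hself, ?_, ?_, ?_⟩
  · exact mk_insert_le.trans_lt (add_lt_of_lt hκ.lift.aleph0_le hS.card_lt hone)
  · intro a ha
    rcases mem_insert_iff.1 ha with rfl | ha
    · exact hτκ
    · exact hS.lt_succ a ha
  · intro a b
    refine (mk_le_mk_of_subset (t := F a b ∪ insert (OrdMap.idOn τ)
      ((fun g : OrdMap.{u} => h.comp g) '' F a t)) ?_).trans_lt ((mk_union_le _ _).trans_lt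
      (add_lt_of_lt hκ.lift.aleph0_le (hS.maps_card_lt _ _) (mk_insert_le.trans_lt
      (add_lt_of_lt hκ.lift.aleph0_le (mk_image_le.trans_lt (hS.maps_card_lt _ _)) hone))))
    rintro f (hf | ⟨-, ⟨-, rfl⟩ | ⟨g, hg, rfl⟩⟩)
    · exact Or.inl hf
    · exact Or.inr (mem_insert _ _)
    · exact Or.inr (mem_insert_of_mem _ ⟨g, hg, rfl⟩)
  · intro a b hab
    have ha : a ∈ Θ := by
      refine (mem_insert_iff.1 hab.left).resolve_left ?_
      rintro rfl
      rcases mem_insert_iff.1 hab.right with rfl | hb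
      · exact hab.lt.false
      · exact hab.lt.not_gt (hτ b hb)
    rcases mem_insert_iff.1 hab.right with rfl | hb
    · have hat : a = t := (hm a ha).antisymm
        (hab.le_of_lt (mem_insert_of_mem _ ht) (hτ t ht))
      subst hat
      refine Or.inl ⟨h, ?_, (ssup_le ?_).trans_lt ho⟩
      · ext f
        rw [hS.mem_addTopMaps_top hτ ha, hS.self ha]
        simp [hh.comp_idOn_of_le le_rfl]
      · rintro y ⟨x, hx⟩
        exact hh.lt x y hx
    · rw [addTopMaps_of_ne (hτ b hb).ne]
      exact hS.cover (hab.of_subset (subset_insert _ _) ha hb)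
  · intro b hb i₀ i₁ g₀ g₁ hi₀ hi₁ hg₀ hg₁
    have hb' := hb.of_insert_top hτ ht hm
    rw [addTopMaps_of_ne (hτ b hb'.mem).ne] at hg₀ hg₁
    obtain ⟨j, h0, h1, hj, f, hf, g₀', hg₀', g₁', hg₁', he⟩ := hS.directed hb' hi₀ hi₁ hg₀ hg₁
    exact ⟨j, h0, h1, hj, f, Or.inl hf, g₀', Or.inl hg₀', g₁', Or.inl hg₁', he⟩
  · intro i j k hij hjk hj f
    rcases mem_insert_iff.1 hj with rfl | hj'
    · have hk : ∀ {g}, g ∈ addTopMaps F t j h j k → k = j := by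
        intro g hg
        rcases mem_insert_iff.1 (hsupp hg).2.1 with rfl | hk
        · rfl
        · exact absurd (hτ k hk) hjk.not_gt
      constructor
      · intro hf
        have hk : k = j := by
          rcases mem_insert_iff.1 (hsupp hf).2.1 with rfl | hk
          · rfl
          · exact absurd (hτ k hk) hjk.not_gt
        subst hk
        refine ⟨f, hf, OrdMap.idOn k, ?_, ((hisOP hf).idOn_comp le_rfl).symm⟩
        rw [hS.addTopMaps_self hτ]
        rfl
      · rintro ⟨f, hf, g, hg, rfl⟩
        have := hk hg
        subst this
        rw [hS.addTopMaps_self hτ] at hg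
        rw [mem_singleton_iff.1 hg, (hisOP hf).idOn_comp le_rfl]
        exact hf
    · rw [addTopMaps_of_ne (hτ j hj').ne]
      rcases eq_or_ne k τ with rfl | hk
      · have hi : ∀ {f}, f ∈ addTopMaps F t k h i k → i ∈ Θ := by
          intro f hf
          refine (mem_insert_iff.1 (hsupp hf).1).resolve_left ?_
          rintro rfl
          exact hij.not_gt (hτ j hj')
        constructor
        · intro hf
          obtain ⟨g, hg, rfl⟩ := (hS.mem_addTopMaps_top hτ (hi hf)).1 hf
          obtain ⟨f', hf', g', hg', rfl⟩ := (hS.factor hij (hm j hj') hj').1 hg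
          exact ⟨f', hf', h.comp g', (hS.mem_addTopMaps_top hτ hj').2 ⟨g', hg', rfl⟩,
            (PFun.comp_assoc _ _ _).symm⟩
        · rintro ⟨f', hf', g, hg, rfl⟩
          obtain ⟨g', hg', rfl⟩ := (hS.mem_addTopMaps_top hτ hj').1 hg
          refine (hS.mem_addTopMaps_top hτ (hS.supp hf').1).2 ⟨g'.comp f',
            (hS.factor hij (hm j hj') hj').2 ⟨f', hf', g', hg', rfl⟩, PFun.comp_assoc _ _ _⟩
      · rw [addTopMaps_of_ne hk, addTopMaps_of_ne hk]
        exact hS.factor hij hjk hj'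

end AddTop

/-! ### Segments and `SMS` -/

namespace SMS

variable {κ : Cardinal.{u}} (S : SMS κ)

/-- The set of the ordinals `θ_i`. -/
def levels : Set Ordinal.{u} := range S.θ

/-- The maps of the segment, with the levels given by the ordinals `θ_i`. -/
def maps (a b : Ordinal.{u}) : Set OrdMap.{u} := {f | ∃ i j, S.θ i = a ∧ S.θ j = b ∧ f ∈ S.F i j}

variable {S}

theorem mem_maps {i j : Iic S.ζ} {f : OrdMap.{u}} : f ∈ S.maps (S.θ i) (S.θ j) ↔ f ∈ S.F i j := by
  constructor
  · rintro ⟨i', j', hi, hj, hf⟩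
    rwa [S.θ_strictMono.injective hi, S.θ_strictMono.injective hj] at hf
  · exact fun hf => ⟨i, j, rfl, rfl, hf⟩

theorem maps_eq (i j : Iic S.ζ) : S.maps (S.θ i) (S.θ j) = S.F i j := by
  ext f
  exact mem_maps

theorem le_of_mem {i j : Iic S.ζ} {f : OrdMap.{u}} (hf : f ∈ S.F i j) : i ≤ j := by
  by_contra! h
  rw [S.F_of_lt i j h] at hf
  exact hf

theorem mem_levels (i : Iic S.ζ) : S.θ i ∈ S.levels := mem_range_self i

theorem le_top_level {a : Ordinal.{u}} (ha : a ∈ S.levels) : a ≤ S.θ S.top := by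
  obtain ⟨i, rfl⟩ := ha
  exact S.θ_strictMono.monotone i.2

theorem eq_add_one_of_isCov {i j : Iic S.ζ} (h : IsCov S.levels (S.θ i) (S.θ j)) :
    (j : Ordinal.{u}) = i + 1 := by
  have hij : i < j := S.θ_strictMono.lt_iff_lt.1 h.lt
  by_contra hne
  have h1 : (i : Ordinal.{u}) + 1 < j := (Order.add_one_le_of_lt (Subtype.coe_lt_coe.2 hij)).lt_of_ne (Ne.symm hne)
  let m : Iic S.ζ := ⟨(i : Ordinal.{u}) + 1, h1.le.trans j.2⟩
  have him : i < m := by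
    rw [← Subtype.coe_lt_coe]
    exact Order.lt_add_one_iff.2 le_rfl
  exact h.not_lt _ (mem_levels m) (S.θ_strictMono him) (S.θ_strictMono h1)

theorem isCov_of_eq_add_one {i j : Iic S.ζ} (h : (j : Ordinal.{u}) = i + 1) :
    IsCov S.levels (S.θ i) (S.θ j) := by
  have hij : i < j := by
    rw [← Subtype.coe_lt_coe, h]
    exact Order.lt_add_one_iff.2 le_rfl
  refine ⟨mem_levels i, mem_levels j, S.θ_strictMono hij, ?_⟩
  rintro _ ⟨m, rfl⟩ h1 h2
  have h1 : (i : Ordinal.{u}) < m := S.θ_strictMono.lt_iff_lt.1 h1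
  have h2 : (m : Ordinal.{u}) < j := S.θ_strictMono.lt_iff_lt.1 h2
  rw [h] at h2
  exact (Order.lt_add_one_iff.1 h2).not_gt h1

theorem isSuccLimit_of_isLim {k : Iic S.ζ} (h : IsLim S.levels (S.θ k)) :
    Order.IsSuccLimit (k : Ordinal.{u}) := by
  refine ⟨fun hmin => ?_, fun i hi => ?_⟩
  · obtain ⟨_, ⟨i, rfl⟩, hik⟩ := h.exists_lt
    have hik : (i : Ordinal.{u}) < k := S.θ_strictMono.lt_iff_lt.1 hik
    exact hmin.not_lt hik
  · let i' : Iic S.ζ := ⟨i, hi.lt.le.trans k.2⟩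
    obtain ⟨_, ⟨m, rfl⟩, h1, h2⟩ := h.between _ (mem_levels i') (S.θ_strictMono hi.lt)
    have h1 : i < (m : Ordinal.{u}) := S.θ_strictMono.lt_iff_lt.1 h1
    have h2 : (m : Ordinal.{u}) < k := S.θ_strictMono.lt_iff_lt.1 h2
    exact hi.2 h1 h2

theorem mk_levels_lt (hκ : κ.IsRegular) : #S.levels < Cardinal.lift.{u + 1} κ := by
  refine mk_range_le.trans_lt ?_
  have h1 : S.ζ + 1 < κ.ord := (isSuccLimit_ord hκ.aleph0_le).add_one_lt S.ζ_lt
  have h2 : Iic S.ζ = Iio (S.ζ + 1) := by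
    ext x
    exact (Order.lt_add_one_iff (x := x) (y := S.ζ)).symm
  rw [h2, mk_Iio_ordinal, lift_lt]
  exact lt_ord.1 h1

theorem isSegment (hκ : κ.IsRegular) : IsSegment κ S.levels S.maps := by
  refine ⟨mk_levels_lt hκ, ?_, ?_, ?_, ?_, ?_, ?_, ?_, ?_⟩
  · rintro _ ⟨i, rfl⟩
    exact S.θ_lt i
  · rintro _ _ f ⟨i, j, rfl, rfl, hf⟩
    exact ⟨mem_levels i, mem_levels j, S.θ_strictMono.monotone (le_of_mem hf)⟩
  · rintro _ _ f ⟨i, j, rfl, rfl, hf⟩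
    exact S.F_isOP i j (le_of_mem hf) f hf
  · intro a b
    by_cases h : ∃ i j, S.θ i = a ∧ S.θ j = b ∧ i ≤ j
    · obtain ⟨i, j, rfl, rfl, hij⟩ := h
      rw [maps_eq]
      exact S.F_card i j hij
    · have : S.maps a b = ∅ := by
        refine eq_empty_of_forall_notMem ?_
        rintro f ⟨i, j, ha, hb, hf⟩
        exact h ⟨i, j, ha, hb, le_of_mem hf⟩
      rw [this, mk_eq_zero]
      exact hκ.lift.pos
  · rintro _ ⟨i, rfl⟩
    rw [maps_eq, S.F_self]
  · intro a b h
    obtain ⟨i, rfl⟩ := h.left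
    obtain ⟨j, rfl⟩ := h.right
    rw [maps_eq]
    exact S.F_succ i j (eq_add_one_of_isCov h)
  · rintro _ h _ _ g₀ g₁ hi₀ hi₁ ⟨i₀, k, rfl, rfl, hg₀⟩ ⟨i₁, k', rfl, hk, hg₁⟩
    obtain rfl := S.θ_strictMono.injective hk
    obtain ⟨j, hj, hjk, f, hf, g₀', hg₀', g₁', hg₁', he⟩ := S.directed k' (isSuccLimit_of_isLim h)
      i₀ i₁ (S.θ_strictMono.lt_iff_lt.1 hi₀) (S.θ_strictMono.lt_iff_lt.1 hi₁) g₀ hg₀ g₁ hg₁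
    exact ⟨S.θ j, S.θ_strictMono.monotone ((le_max_left _ _).trans hj),
      S.θ_strictMono.monotone ((le_max_right _ _).trans hj), S.θ_strictMono hjk, f, mem_maps.2 hf,
      g₀', mem_maps.2 hg₀', g₁', mem_maps.2 hg₁', he⟩
  · rintro a _ c hij hjk ⟨j, rfl⟩ f
    constructor
    · rintro ⟨i, k, rfl, rfl, hf⟩
      rw [S.factor i j k (S.θ_strictMono.le_iff_le.1 hij) (S.θ_strictMono.le_iff_le.1 hjk)] at hf
      obtain ⟨f', hf', g, hg, he⟩ := hf
      exact ⟨f', mem_maps.2 hf', g, mem_maps.2 hg, he⟩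
    · rintro ⟨f', ⟨i, j', rfl, hj, hf'⟩, g, ⟨j'', k, hj', rfl, hg⟩, he⟩
      obtain rfl := S.θ_strictMono.injective hj
      obtain rfl := S.θ_strictMono.injective hj'
      rw [mem_maps, S.factor i j'' k (le_of_mem hf') (le_of_mem hg)]
      exact ⟨f', hf', g, hg, he⟩

theorem hasSmallCof : HasSmallCof κ S.levels := by
  intro b hb
  obtain ⟨k, rfl⟩ := hb.mem
  exact S.cof_lt k (isSuccLimit_of_isLim hb)

end SMS

/-- A segment with a top level and small cofinalities comes from an `SMS`. -/
theorem IsSegment.exists_sms {κ : Cardinal.{u}} {Θ : Set Ordinal.{u}}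
    {F : Ordinal.{u} → Ordinal.{u} → Set OrdMap.{u}} (hS : IsSegment κ Θ F)
    (hc : HasSmallCof κ Θ) {τ : Ordinal.{u}} (hτ : τ ∈ Θ) (hm : ∀ a ∈ Θ, a ≤ τ) :
    ∃ S : SMS κ, S.levels = Θ ∧ S.maps = F ∧ S.θ S.top = τ := by
  -- Padding `Θ` above its maximum makes it unbounded, so that `enumOrd` applies; the values at
  -- arguments up to `ζ` are exactly the elements of `Θ`.
  let s := Θ ∪ Ici τ
  have hs : ¬ BddAbove s := fun h => not_bddAbove_Ici τ (h.mono subset_union_right)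
  let e := Ordinal.enumOrd s
  have he : StrictMono e := Ordinal.enumOrd_strictMono hs
  obtain ⟨ζ, hζ⟩ : ∃ ζ, e ζ = τ := Ordinal.enumOrd_surjective hs (Or.inl hτ)
  have hmem : ∀ i ≤ ζ, e i ∈ Θ := by
    intro i hi
    rcases (Ordinal.enumOrd_mem hs i : e i ∈ s) with h | h
    · exact h
    · rwa [le_antisymm ((he.monotone hi).trans_eq hζ) h]
  have hex : ∀ a ∈ Θ, ∃ i ≤ ζ, e i = a := by
    intro a ha
    obtain ⟨i, hi⟩ := Ordinal.enumOrd_surjective hs (Or.inl ha : a ∈ s)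
    refine ⟨i, he.le_iff_le.1 ?_, hi⟩
    rw [hζ]
    exact hi.trans_le (hm a ha)
  have hlim : ∀ k ≤ ζ, Order.IsSuccLimit k → IsLim Θ (e k) := by
    intro k hk hl
    refine ⟨hmem k hk, ⟨e 0, hmem 0 (zero_le), he hl.bot_lt⟩, fun a ha hak => ?_⟩
    obtain ⟨i, hi, rfl⟩ := hex a ha
    have h1 := hl.add_one_lt (he.lt_iff_lt.1 hak)
    exact ⟨e (i + 1), hmem _ (h1.le.trans hk), he (Order.lt_add_one_iff.2 le_rfl), he h1⟩
  let S : SMS κ :=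
    { ζ := ζ
      θ := fun i => e i
      F := fun i j => F (e i) (e j)
      F_of_lt := by
        intro i j hij
        refine eq_empty_of_forall_notMem fun f hf => ?_
        exact (he (Subtype.coe_lt_coe.2 hij)).not_ge (hS.supp hf).2.2
      ζ_lt := by
        rw [lt_ord, ← Cardinal.lift_lt.{u, u + 1}, ← mk_Iio_ordinal]
        refine lt_of_le_of_lt ?_ hS.card_lt
        refine mk_le_of_injective (f := fun i : Iio ζ => (⟨e i, hmem i i.2.le⟩ : Θ)) ?_
        intro i j hij
        exact Subtype.ext (he.injective (congrArg Subtype.val hij))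
      θ_lt := fun i => hS.lt_succ _ (hmem i i.2)
      θ_strictMono := fun i j hij => he hij
      cof_lt := fun k hk => hc _ (hlim k k.2 hk)
      F_isOP := fun i j _ f hf => hS.isOP hf
      F_card := fun i j _ => hS.maps_card_lt _ _
      F_self := fun i => hS.self (hmem i i.2)
      F_succ := by
        intro i j hij
        refine hS.cover ⟨hmem i i.2, hmem j j.2, he ?_, fun c hcm h1 h2 => ?_⟩
        · rw [hij]
          exact Order.lt_add_one_iff.2 le_rfl
        · obtain ⟨m, -, rfl⟩ := hex c hcm
          have h2 := he.lt_iff_lt.1 h2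
          rw [hij] at h2
          exact (Order.lt_add_one_iff.1 h2).not_gt (he.lt_iff_lt.1 h1)
      directed := by
        intro k hk i₀ i₁ hi₀ hi₁ g₀ hg₀ g₁ hg₁
        obtain ⟨j, h0, h1, hj, f, hf, g₀', hg₀', g₁', hg₁', h⟩ :=
          hS.directed (hlim k k.2 hk) (he hi₀) (he hi₁) hg₀ hg₁
        obtain ⟨j, hjζ, rfl⟩ := hex j (hS.supp hf).1
        exact ⟨⟨j, hjζ⟩, max_le (he.le_iff_le.1 h0) (he.le_iff_le.1 h1), he.lt_iff_lt.1 hj, f, hf,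
          g₀', hg₀', g₁', hg₁', h⟩
      factor := by
        intro i j k hij hjk
        ext f
        exact hS.factor (he.monotone hij) (he.monotone hjk) (hmem j j.2) }
  refine ⟨S, ?_, ?_, hζ⟩
  · ext a
    constructor
    · rintro ⟨i, rfl⟩
      exact hmem i i.2
    · intro ha
      obtain ⟨i, hi, rfl⟩ := hex a ha
      exact ⟨⟨i, hi⟩, rfl⟩
  · funext a b
    ext f
    constructor
    · rintro ⟨i, j, rfl, rfl, hf⟩
      exact hf
    · intro hf
      obtain ⟨ha, hb, -⟩ := hS.supp hf
      obtain ⟨i, hi, rfl⟩ := hex a ha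
      obtain ⟨j, hj, rfl⟩ := hex b hb
      exact ⟨⟨i, hi⟩, ⟨j, hj⟩, rfl, rfl, hf⟩

/-! ### The order of the forcing, free of the index embedding. -/

namespace Condition

variable {κ lam : Cardinal.{u}} {tri : incSeqs κ lam → incSeqs κ lam → Prop}

/-- The order of the forcing in terms of the levels `θ_i`. -/
theorem extends_iff {q p : Condition tri} : q.Extends p ↔
    SegExt p.S.levels p.S.maps q.S.levels q.S.maps ∧
    ∃ f ∈ q.S.maps (p.S.θ p.S.top) (q.S.θ q.S.top), p.F = q.F.comp f ∧ p.𝒩 ⊆ q.𝒩 ∧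
      ∀ N ∈ q.𝒩, ∀ a, ∀ g ∈ p.S.maps a (p.S.θ p.S.top), Fits lam N (p.F.comp g) → N ∈ p.𝒩 := by
  constructor
  · rintro ⟨k, hk, hF, hcov, f, hf, hFf, hN, hW⟩
    refine ⟨⟨?_, ?_, ?_⟩, f, ?_, hFf, hN, ?_⟩
    · rintro _ ⟨i, rfl⟩
      rw [hk]
      exact SMS.mem_levels _
    · rintro _ _ f ⟨i, j, rfl, rfl, hf⟩
      rw [hk, hk, SMS.mem_maps]
      exact hF i j (SMS.le_of_mem hf) hf
    · intro a b hab hab'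
      obtain ⟨i, rfl⟩ := hab.left
      obtain ⟨j, rfl⟩ := hab.right
      rw [SMS.maps_eq, hk, hk, SMS.maps_eq]
      rw [hk, hk] at hab'
      exact hcov i j (SMS.eq_add_one_of_isCov hab) (SMS.eq_add_one_of_isCov hab')
    · rwa [hk, SMS.mem_maps]
    · rintro N hNq a g ⟨i, j, rfl, hj, hg⟩ hfit
      obtain rfl := p.S.θ_strictMono.injective hj
      refine hW N hNq i g hg ⟨?_, ?_⟩
      · rw [q.S.factor (k i) (k p.S.top) q.S.top (k.monotone (SMS.le_of_mem hg)) (le_top q _)]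
        exact ⟨g, hF _ _ (SMS.le_of_mem hg) hg, f, hf, rfl⟩
      · rwa [← PFun.comp_assoc, ← hFf]
  · rintro ⟨hext, f, hf, hFf, hN, hW⟩
    -- The embedding is determined by the levels: `k i` is the index at which `q` lists the ordinal
    -- `p.S.θ i`.
    have hk : ∀ i, ∃ j, q.S.θ j = p.S.θ i := fun i => hext.levels (SMS.mem_levels i)
    choose k hk using hk
    have hkm : StrictMono k := fun i j hij => by
      rw [← q.S.θ_strictMono.lt_iff_lt, hk, hk]
      exact p.S.θ_strictMono hij
    refine ⟨OrderEmbedding.ofStrictMono k hkm, fun i => (hk i).symm, ?_, ?_, f, ?_, hFf, hN, ?_⟩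
    · intro i j _ f hf
      change f ∈ q.S.F (k i) (k j)
      rw [← SMS.mem_maps, hk, hk]
      exact hext.maps _ _ (SMS.mem_maps.2 hf)
    · intro i j hij hkij
      change p.S.F i j = q.S.F (k i) (k j)
      rw [← SMS.maps_eq, ← SMS.maps_eq, hk, hk]
      have h := SMS.isCov_of_eq_add_one (S := q.S) hkij
      change IsCov _ (q.S.θ (k i)) (q.S.θ (k j)) at h
      rw [hk, hk] at h
      exact hext.cover_eq (SMS.isCov_of_eq_add_one hij) h
    · change f ∈ q.S.F (k p.S.top) q.S.top
      rwa [← SMS.mem_maps, hk]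
    · intro N hNq i g hg hw
      refine hW N hNq (p.S.θ i) g (SMS.mem_maps.2 hg) ?_
      rw [hFf, PFun.comp_assoc]
      exact hw.2

end Condition

/-! ### First-order facts about `(H_χ, ∈)` and its elementary submodels -/

section Sentences

open FirstOrder Language BoundedFormula

/-- The atomic formula `s ∈ t`. -/
def memFormula {n : ℕ} (s t : langMem.Term (Empty ⊕ Fin n)) : langMem.BoundedFormula Empty n :=
  Relations.boundedFormula₂ (L := langMem) SetRel₁.mem s t

/-- The relation interpreting the membership symbol. -/
def RelMem {X : Type*} [langMem.Structure X] (x y : X) : Prop :=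
  Structure.RelMap (L := langMem) SetRel₁.mem ![x, y]

theorem realize_memFormula {X : Type*} [langMem.Structure X] {n : ℕ}
    {s t : langMem.Term (Empty ⊕ Fin n)} {v : Empty → X} {xs : Fin n → X} :
    (memFormula s t).Realize v xs ↔
      RelMem (s.realize (Sum.elim v xs)) (t.realize (Sum.elim v xs)) :=
  BoundedFormula.realize_rel₂

/-- Extensionality. -/
def extSentence : langMem.Sentence :=
  ∀' ∀' ((∀' ((memFormula (&2) (&0)).iff (memFormula (&2) (&1)))).imp ((&0) =' (&1)))

/-- For all `y` and `a` there is the set of all `u ∈ y` with `{v} ∈ u` for some `v ∈ a`. -/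
def restrictSentence : langMem.Sentence :=
  ∀' ∀' ∃' ∀' ((memFormula (&3) (&2)).iff ((memFormula (&3) (&0)) ⊓
    ∃' ((memFormula (&4) (&1)) ⊓ ∃' ((memFormula (&5) (&3)) ⊓
      ∀' ((memFormula (&6) (&5)).iff ((&6) =' (&4)))))))

/-- For all `a` there is the set of all `{{y}}` with `y ∈ a`. -/
def idSentence : langMem.Sentence :=
  ∀' ∃' ((∀' ((memFormula (&2) (&1)).imp (∃' ((memFormula (&3) (&0)) ⊓
      ∃' ((∀' ((memFormula (&5) (&4)).iff ((&5) =' (&3)))) ⊓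
        ∀' ((memFormula (&5) (&2)).iff ((&5) =' (&4)))))))) ⊓
    ∀' ((memFormula (&2) (&0)).imp (∃' ((memFormula (&3) (&1)) ⊓
      ∃' ((∀' ((memFormula (&5) (&4)).iff ((&5) =' (&2)))) ⊓
        ∀' ((memFormula (&5) (&3)).iff ((&5) =' (&4))))))))

variable {X : Type*} [langMem.Structure X]

theorem realize_extSentence :
    X ⊨ extSentence ↔ ∀ x y : X, (∀ z, RelMem z x ↔ RelMem z y) → x = y := by
  simp [extSentence, Sentence.Realize, Formula.Realize, realize_memFormula, Fin.snoc]

theorem realize_restrictSentence :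
    X ⊨ restrictSentence ↔ ∀ y a : X, ∃ w, ∀ u, RelMem u w ↔ RelMem u y ∧
      ∃ v, RelMem v a ∧ ∃ s, RelMem s u ∧ ∀ t, RelMem t s ↔ t = v := by
  simp [restrictSentence, Sentence.Realize, Formula.Realize, realize_memFormula, Fin.snoc]

theorem realize_idSentence :
    X ⊨ idSentence ↔ ∀ a : X, ∃ z,
      (∀ w, RelMem w z → ∃ y, RelMem y a ∧ ∃ s, (∀ t, RelMem t s ↔ t = y) ∧
        ∀ t, RelMem t w ↔ t = s) ∧
      ∀ y, RelMem y a → ∃ w, RelMem w z ∧ ∃ s, (∀ t, RelMem t s ↔ t = y) ∧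
        ∀ t, RelMem t w ↔ t = s := by
  simp [idSentence, Sentence.Realize, Formula.Realize, realize_memFormula, Fin.snoc]

end Sentences

/-! ### Elements of the transitive collapse of an elementary submodel. -/

section Collapse

attribute [local instance] memStructure

theorem relMem_iff {A : Set ZFSet.{u}} {x y : A} : RelMem x y ↔ x.1 ∈ y.1 := Iff.rfl

theorem mem_collapseMap {N x z : ZFSet.{u}} :
    z ∈ collapseMap N x ↔ ∃ y ∈ x, y ∈ N ∧ collapseMap N y = z := by
  rw [collapseMap, ZFSet.mem_range]
  constructor
  · rintro ⟨⟨y, hy⟩, rfl⟩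
    exact ⟨y, (ZFSet.mem_inter.1 hy).1, (ZFSet.mem_inter.1 hy).2, rfl⟩
  · rintro ⟨y, hy, hyN, rfl⟩
    exact ⟨⟨y, ZFSet.mem_inter.2 ⟨hy, hyN⟩⟩, rfl⟩

theorem mem_collapse {N z : ZFSet.{u}} : z ∈ collapse N ↔ ∃ y ∈ N, collapseMap N y = z := by
  rw [collapse, ZFSet.mem_range]
  constructor
  · rintro ⟨⟨y, hy⟩, rfl⟩
    exact ⟨y, hy, rfl⟩
  · rintro ⟨y, hy, rfl⟩
    exact ⟨⟨y, hy⟩, rfl⟩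

theorem mem_collapse_of_mem {N x z : ZFSet.{u}} (hz : z ∈ collapse N) (hx : x ∈ z) :
    x ∈ collapse N := by
  obtain ⟨y, -, rfl⟩ := mem_collapse.1 hz
  obtain ⟨w, -, hw, rfl⟩ := mem_collapseMap.1 hx
  exact mem_collapse.2 ⟨w, hw, rfl⟩

/-- By `∈`-induction, elements with equal collapses have the same members inside `N`; extensionality
in `N` then identifies them. -/
theorem collapseMap_injOn {N : ZFSet.{u}}
    (hN : ∀ x ∈ N, ∀ y ∈ N, (∀ z ∈ N, z ∈ x ↔ z ∈ y) → x = y) {x y : ZFSet.{u}} (hx : x ∈ N)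
    (hy : y ∈ N) (h : collapseMap N x = collapseMap N y) : x = y := by
  induction x using ZFSet.inductionOn generalizing y with
  | _ x ih =>
    refine hN x hx y hy fun z hz => ⟨fun hzx => ?_, fun hzy => ?_⟩
    · have : collapseMap N z ∈ collapseMap N y := h ▸ mem_collapseMap.2 ⟨z, hzx, hz, rfl⟩
      obtain ⟨w, hwy, hw, he⟩ := mem_collapseMap.1 this
      rwa [ih z hzx hz hw he.symm]
    · have : collapseMap N z ∈ collapseMap N x := h ▸ mem_collapseMap.2 ⟨z, hzy, hz, rfl⟩
      obtain ⟨w, hwx, hw, he⟩ := mem_collapseMap.1 this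
      rwa [← ih w hwx hw hz he]

/-- The transitive collapse of an elementary submodel satisfies the same sentences. -/
theorem IsElemMem.realize_collapse {N : ZFSet.{u}} {A : Set ZFSet.{u}} (h : IsElemMem N A)
    (hA : ∀ x ∈ A, ∀ y ∈ x, y ∈ A) {φ : langMem.Sentence}
    (hφ : FirstOrder.Language.Sentence.Realize A φ) :
    FirstOrder.Language.Sentence.Realize {z : ZFSet.{u} | z ∈ collapse N} φ := by
  obtain ⟨hNA, S, hS⟩ := h
  have hext : ∀ x ∈ N, ∀ y ∈ N, (∀ z ∈ N, z ∈ x ↔ z ∈ y) → x = y := by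
    have hAext : FirstOrder.Language.Sentence.Realize A extSentence := by
      refine realize_extSentence.2 fun x y hxy => Subtype.ext (ZFSet.ext fun z => ?_)
      exact ⟨fun hz => (hxy ⟨z, hA _ x.2 z hz⟩).1 hz, fun hz => (hxy ⟨z, hA _ y.2 z hz⟩).2 hz⟩
    have hSext := realize_extSentence.1 ((S.realize_sentence _).2 hAext)
    intro x hx y hy hxy
    have := hSext ⟨⟨x, hNA x hx⟩, (hS _).2 hx⟩ ⟨⟨y, hNA y hy⟩, (hS _).2 hy⟩
      fun z => hxy z.1.1 ((hS _).1 z.2)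
    exact congrArg (fun z : S => z.1.1) this
  -- The collapsing map is an `∈`-isomorphism from the submodel onto the collapse, so sentences
  -- transfer.
  let f : S → {z : ZFSet.{u} | z ∈ collapse N} := fun x =>
    ⟨collapseMap N x.1.1, mem_collapse.2 ⟨_, (hS _).1 x.2, rfl⟩⟩
  have hf : Function.Bijective f := by
    constructor
    · intro x y hxy
      exact Subtype.ext (Subtype.ext (collapseMap_injOn hext ((hS _).1 x.2) ((hS _).1 y.2)
        (congrArg Subtype.val hxy)))
    · rintro ⟨z, hz⟩
      obtain ⟨y, hy, rfl⟩ := mem_collapse.1 hz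
      exact ⟨⟨⟨y, hNA y hy⟩, (hS _).2 hy⟩, rfl⟩
  have hmem : ∀ x y : S, (f x).1 ∈ (f y).1 ↔ x.1.1 ∈ y.1.1 := by
    intro x y
    refine mem_collapseMap.trans ⟨?_, fun h => ⟨x.1.1, h, (hS _).1 x.2, rfl⟩⟩
    rintro ⟨w, hwy, hw, he⟩
    rwa [← collapseMap_injOn hext hw ((hS _).1 x.2) he]
  let e : langMem.Equiv S {z : ZFSet.{u} | z ∈ collapse N} :=
    { Equiv.ofBijective f hf with
      map_fun' := fun g => Empty.elim g
      map_rel' := by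
        rintro n ⟨⟩ x
        exact hmem (x 0) (x 1) }
  exact (FirstOrder.Language.StrongHomClass.realize_sentence e φ).1 ((S.realize_sentence φ).2 hφ)

theorem Hset.mem_of_mem {χ : Cardinal.{u}} {x y : ZFSet.{u}} (hx : x ∈ Hset χ) (hy : y ∈ x) :
    y ∈ Hset χ := by
  obtain ⟨t, ht, hxt, hc⟩ := hx
  exact ⟨t, ht, ht y (hxt hy), hc⟩

theorem Hset.mem_of_subset {χ : Cardinal.{u}} {x y : ZFSet.{u}} (hx : x ∈ Hset χ) (hy : y ⊆ x) :
    y ∈ Hset χ := by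
  obtain ⟨t, ht, hxt, hc⟩ := hx
  exact ⟨t, ht, fun z hz => hxt (hy hz), hc⟩

/-- `H_χ` contains every subset of each of its elements, so the required set is obtained by
separation. -/
theorem Hset.realize_restrictSentence (χ : Cardinal.{u}) :
    FirstOrder.Language.Sentence.Realize (Hset χ) restrictSentence := by
  refine _root_.realize_restrictSentence.2 fun y a => ?_
  let P : Hset χ → Prop := fun u => ∃ v, RelMem v a ∧ ∃ s, RelMem s u ∧ ∀ t, RelMem t s ↔ t = v
  refine ⟨⟨ZFSet.sep (fun u => ∃ h : u ∈ Hset χ, P ⟨u, h⟩) y.1,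
    Hset.mem_of_subset y.2 fun z hz => (ZFSet.mem_sep.1 hz).1⟩, fun u => ?_⟩
  have hu : (∃ h : u.1 ∈ Hset χ, P ⟨u.1, h⟩) ↔ P u := ⟨fun h => h.2, fun h => ⟨u.2, h⟩⟩
  rw [relMem_iff, ZFSet.mem_sep, hu]
  rfl

theorem eq_singleton_iff_forall_mem {x y : ZFSet.{u}} : (∀ t, t ∈ x ↔ t = y) ↔ x = {y} := by
  rw [ZFSet.ext_iff]
  simp only [ZFSet.mem_singleton]

/-- The range of `y ↦ {{y}}` on a set. -/
noncomputable def doubleSingletons (a : ZFSet.{u}) : ZFSet.{u} :=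
  ZFSet.image (fun y => {y}) (ZFSet.image (fun y => {y}) a)

theorem mem_doubleSingletons {a w : ZFSet.{u}} : w ∈ doubleSingletons a ↔ ∃ y ∈ a, w = {{y}} := by
  simp only [doubleSingletons, ZFSet.mem_image]
  constructor
  · rintro ⟨_, ⟨y, hy, rfl⟩, rfl⟩
    exact ⟨y, hy, rfl⟩
  · rintro ⟨y, hy, rfl⟩
    exact ⟨_, ⟨y, hy, rfl⟩, rfl⟩

theorem Hset.doubleSingletons_mem {χ : Cardinal.{u}} (hχ : ℵ₀ ≤ χ) {a : ZFSet.{u}}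
    (ha : a ∈ Hset χ) : doubleSingletons a ∈ Hset χ := by
  obtain ⟨t, ht, hat, hc⟩ := ha
  -- Adding to `t` its singletons and its double singletons keeps it transitive, and each layer is
  -- no larger than `t`.
  refine ⟨t ∪ (ZFSet.image (fun y => {y}) t ∪ doubleSingletons t), ?_, ?_, ?_⟩
  · intro x hx y hy
    simp only [ZFSet.mem_union, mem_doubleSingletons, ZFSet.mem_image] at hx ⊢
    rcases hx with hx | ⟨z, hz, rfl⟩ | ⟨z, hz, rfl⟩
    · exact Or.inl (ht x hx hy)
    · rw [ZFSet.mem_singleton.1 hy]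
      exact Or.inl hz
    · rw [ZFSet.mem_singleton.1 hy]
      exact Or.inr (Or.inl ⟨z, hz, rfl⟩)
  · intro w hw
    obtain ⟨y, hy, rfl⟩ := mem_doubleSingletons.1 hw
    simp only [ZFSet.mem_union, mem_doubleSingletons]
    exact Or.inr (Or.inr ⟨y, hat hy, rfl⟩)
  · have h1 : (ZFSet.image (fun y => {y}) t).card < χ := ZFSet.card_image_le.trans_lt hc
    have h2 : (doubleSingletons t).card < χ := ZFSet.card_image_le.trans_lt h1
    exact ZFSet.card_union_le.trans_lt (add_lt_of_lt hχ hc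
      (ZFSet.card_union_le.trans_lt (add_lt_of_lt hχ h1 h2)))

/-- In a transitive set, being a singleton is absolute. -/
theorem forall_relMem_iff_eq_iff {A : Set ZFSet.{u}} (hA : ∀ x ∈ A, ∀ y ∈ x, y ∈ A) {x y : A} :
    (∀ t : A, t.1 ∈ x.1 ↔ t = y) ↔ x.1 = {y.1} := by
  rw [← eq_singleton_iff_forall_mem]
  constructor
  · intro h t
    constructor
    · intro ht
      exact congrArg Subtype.val ((h ⟨t, hA _ x.2 t ht⟩).1 ht)
    · rintro rfl
      exact (h y).2 rfl
  · intro h t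
    rw [h, Subtype.ext_iff]

theorem Hset.realize_idSentence {χ : Cardinal.{u}} (hχ : ℵ₀ ≤ χ) :
    FirstOrder.Language.Sentence.Realize (Hset χ) idSentence := by
  refine _root_.realize_idSentence.2 fun a => ?_
  have hA : ∀ x ∈ Hset χ, ∀ y ∈ x, y ∈ Hset χ := fun _ hx _ => Hset.mem_of_mem hx
  simp only [forall_relMem_iff_eq_iff hA, relMem_iff]
  have hz := Hset.doubleSingletons_mem hχ a.2
  refine ⟨⟨_, hz⟩, fun w hw => ?_, fun y hy => ?_⟩
  · obtain ⟨y, hy, hw⟩ := mem_doubleSingletons.1 hw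
    exact ⟨⟨y, hA _ a.2 _ hy⟩, hy, ⟨{y}, hA _ w.2 _ (hw ▸ ZFSet.mem_singleton.2 rfl)⟩, rfl, hw⟩
  · have hw : ({{y.1}} : ZFSet.{u}) ∈ doubleSingletons a.1 := mem_doubleSingletons.2 ⟨_, hy, rfl⟩
    have hwA := hA _ hz _ hw
    exact ⟨⟨_, hwA⟩, hw, ⟨{y.1}, hA _ hwA _ (ZFSet.mem_singleton.2 rfl)⟩, rfl, rfl⟩

/-- This expresses the first coordinate of a Kuratowski pair through its singleton members, so that
restriction of a function needs no formula for pairs. -/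
theorem singleton_mem_pair_iff {x y v : ZFSet.{u}} : {v} ∈ ZFSet.pair x y ↔ v = x := by
  rw [ZFSet.pair, ZFSet.mem_pair]
  constructor
  · rintro (h | h)
    · exact ZFSet.singleton_injective h
    · have : x ∈ ({v} : ZFSet.{u}) := h ▸ ZFSet.mem_pair.2 (Or.inl rfl)
      exact (ZFSet.mem_singleton.1 this).symm
  · rintro rfl
    exact Or.inl rfl

/-- The graph of an identity map thus consists of double singletons, which is what `idSentence`
provides. -/
theorem pair_self_eq (x : ZFSet.{u}) : ZFSet.pair x x = {{x}} := by
  simp [ZFSet.pair]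

variable {N : ZFSet.{u}} {χ : Cardinal.{u}}

/-- The collapse is closed under restrictions of maps to its ordinals. -/
theorem IsElemMem.restrict_memSet (h : IsElemMem N (Hset χ)) {f : OrdMap.{u}} {x : Ordinal.{u}}
    (hf : f.MemSet (collapse N)) (hx : x.toZFSet ∈ collapse N) :
    OrdMap.MemSet (f.comp (OrdMap.idOn x)) (collapse N) := by
  obtain ⟨z, hz, hfz⟩ := hf
  have hC : ∀ z ∈ {z : ZFSet.{u} | z ∈ collapse N}, ∀ y ∈ z, y ∈ {z : ZFSet.{u} | z ∈ collapse N} :=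
    fun _ hz _ hy => mem_collapse_of_mem hz hy
  have hres := realize_restrictSentence.1 (h.realize_collapse (fun _ hx _ => Hset.mem_of_mem hx)
    (Hset.realize_restrictSentence χ))
  simp only [forall_relMem_iff_eq_iff hC, relMem_iff] at hres
  obtain ⟨w, hw⟩ := hres ⟨z, hz⟩ ⟨_, hx⟩
  refine ⟨w.1, w.2, fun q => ?_⟩
  have key : ∀ q ∈ z, q ∈ w.1 ↔ ∃ v ∈ x.toZFSet, {v} ∈ q := by
    intro q hq
    have hqC := mem_collapse_of_mem hz hq
    refine (hw ⟨q, hqC⟩).trans ⟨?_, ?_⟩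
    · rintro ⟨-, v, hv, s, hs, hsv⟩
      exact ⟨v, hv, hsv ▸ hs⟩
    · rintro ⟨v, hv, hvq⟩
      exact ⟨hq, ⟨v, mem_collapse_of_mem hx hv⟩, hv, ⟨_, mem_collapse_of_mem hqC hvq⟩, hvq, rfl⟩
  constructor
  · intro hq
    have hqz : q ∈ z := ((hw ⟨q, mem_collapse_of_mem w.2 hq⟩).1 hq).1
    obtain ⟨a, b, hab, rfl⟩ := (hfz q).1 hqz
    obtain ⟨v, hv, hvq⟩ := (key _ hqz).1 hq
    rw [singleton_mem_pair_iff.1 hvq, Ordinal.toZFSet_mem_toZFSet_iff] at hv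
    exact ⟨a, b, OrdMap.mem_comp_idOn.2 ⟨hv, hab⟩, rfl⟩
  · rintro ⟨a, b, hab, rfl⟩
    obtain ⟨hax, hab⟩ := OrdMap.mem_comp_idOn.1 hab
    exact (key _ ((hfz _).2 ⟨a, b, hab, rfl⟩)).2
      ⟨_, Ordinal.toZFSet_mem_toZFSet_iff.2 hax, singleton_mem_pair_iff.2 rfl⟩

/-- The collapse contains the identity maps of its ordinals. -/
theorem IsElemMem.idOn_memSet (h : IsElemMem N (Hset χ)) (hχ : ℵ₀ ≤ χ) {x : Ordinal.{u}}
    (hx : x.toZFSet ∈ collapse N) : (OrdMap.idOn x).MemSet (collapse N) := by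
  have hC : ∀ z ∈ {z : ZFSet.{u} | z ∈ collapse N}, ∀ y ∈ z, y ∈ {z : ZFSet.{u} | z ∈ collapse N} :=
    fun _ hz _ hy => mem_collapse_of_mem hz hy
  have hid := realize_idSentence.1 (h.realize_collapse (fun _ hx _ => Hset.mem_of_mem hx)
    (Hset.realize_idSentence hχ))
  simp only [forall_relMem_iff_eq_iff hC, relMem_iff] at hid
  obtain ⟨z, hz, hz'⟩ := hid ⟨_, hx⟩
  refine ⟨z.1, z.2, fun w => ⟨fun hw => ?_, ?_⟩⟩
  · obtain ⟨y, hy, s, hs, hw⟩ := hz ⟨w, mem_collapse_of_mem z.2 hw⟩ hw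
    obtain ⟨o, ho, hoy⟩ := Ordinal.mem_toZFSet_iff.1 hy
    refine ⟨o, o, OrdMap.mem_idOn.2 ⟨ho, rfl⟩, ?_⟩
    rw [pair_self_eq, hoy, ← hs]
    exact hw
  · rintro ⟨o, o', hoo, rfl⟩
    obtain ⟨ho, rfl⟩ := OrdMap.mem_idOn.1 hoo
    have hox : o.toZFSet ∈ x.toZFSet := Ordinal.toZFSet_mem_toZFSet_iff.2 ho
    obtain ⟨w, hw, s, hs, he⟩ := hz' ⟨_, mem_collapse_of_mem hx hox⟩ hox
    rw [pair_self_eq]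
    rw [hs] at he
    rwa [he] at hw

/-- If `N` fits `f`, then every ordinal in the domain of `f` lies in the collapse of `N`. -/
theorem Fits.toZFSet_mem_collapse {lam : Cardinal.{u}} {f : OrdMap.{u}} {θ : Ordinal.{u}}
    (h : Fits lam N f) (hf : f.IsOP θ lam.ord) {x : Ordinal.{u}} (hx : x < θ) :
    x.toZFSet ∈ collapse N := by
  have hmem : ∀ {x y}, y ∈ f x → y.toZFSet ∈ N := by
    intro x y hy
    have : y ∈ f.ran := ⟨x, hy⟩
    rw [h] at this
    exact this.2
  -- The members of `f x` that lie in `N` are exactly the values of `f` at arguments below `x`; by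
  -- induction `f x` collapses to `x`.
  have key : ∀ x y, y ∈ f x → collapseMap N y.toZFSet = x.toZFSet := by
    intro x
    induction x using WellFoundedLT.induction with
    | ind x ih =>
      intro y hy
      ext z
      rw [mem_collapseMap, Ordinal.mem_toZFSet_iff]
      constructor
      · rintro ⟨w, hw, hwN, rfl⟩
        obtain ⟨w, hwy, rfl⟩ := Ordinal.mem_toZFSet_iff.1 hw
        have : w ∈ f.ran := by
          rw [h]
          exact ⟨hwy.trans (hf.lt _ _ hy), hwN⟩
        obtain ⟨v, hv⟩ := this
        have hvx := hf.lt_of_lt hv hy hwy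
        exact ⟨v, hvx, (ih v hvx w hv).symm⟩
      · rintro ⟨v, hvx, rfl⟩
        obtain ⟨w, hw⟩ := hf.exists_mem (hvx.trans (hf.lt_dom hy))
        exact ⟨w.toZFSet, Ordinal.toZFSet_mem_toZFSet_iff.2 (hf.strictMono _ _ _ _ hw hy hvx),
          hmem hw, ih v hvx w hw⟩
  obtain ⟨y, hy⟩ := hf.exists_mem hx
  exact mem_collapse.2 ⟨_, hmem hy, key x y hy⟩

end Collapse

/-! ### Covering the ranges of the whole chain by one map. -/

/-- A small set of ordinals below a regular cardinal is bounded there. -/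
theorem exists_subset_Iio_of_mk_lt {lam : Cardinal.{u}} (hlam : lam.IsRegular)
    {R : Set Ordinal.{u}} (hR : R ⊆ Iio lam.ord) (hc : #R < Cardinal.lift.{u + 1} lam) :
    ∃ ρ < lam.ord, R ⊆ Iio ρ := by
  have hlt : ⨆ i : R, (i : Ordinal.{u}) + 1 < lam.ord := by
    refine Ordinal.lift_iSup_add_one_lt_of_lt_cof ?_ fun i => hR i.2
    rw [← Ordinal.lift_cof, hlam.cof_ord, lift_id'.{u, u + 1}]
    exact hc
  refine ⟨_, hlt, fun x hx => Order.add_one_le_iff.1 (le_ciSup (f := fun i : R =>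
    (i : Ordinal.{u}) + 1) ⟨lam.ord, ?_⟩ ⟨x, hx⟩)⟩
  rintro _ ⟨i, rfl⟩
  exact Order.add_one_le_of_lt (hR i.2)

/-- A set of at most `κ` ordinals below `lam` is covered by the range of an increasing map whose
domain is a successor ordinal below `κ⁺`. -/
theorem exists_isOP_covering {κ lam : Cardinal.{u}} (hκ : κ.IsRegular) (hlam : lam.IsRegular)
    (hκlam : Order.succ κ < lam) {R : Set Ordinal.{u}} (hR : R ⊆ Iio lam.ord)
    (hc : #R < Cardinal.lift.{u + 1} (Order.succ κ)) :
    ∃ (o : Ordinal.{u}) (G : OrdMap.{u}), o + 1 < (Order.succ κ).ord ∧ G.IsOP (o + 1) lam.ord ∧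
      ∀ t (f : OrdMap.{u}), f.IsOP t lam.ord → f.ran ⊆ R →
        ∃ h : OrdMap.{u}, h.IsOP t o ∧ G.comp h = f := by
  obtain ⟨ρ, hρ, hRρ⟩ := exists_subset_Iio_of_mk_lt hlam hR (hc.trans (Cardinal.lift_lt.2 hκlam))
  -- The enumeration of `s` runs through `R` first and reaches `ρ` at position `o`. Keeping the
  -- point `o` in the domain leaves room above every factor map, whose range lies in `o`.
  let s := R ∪ Ici ρ
  have hs : ¬ BddAbove s := fun h => not_bddAbove_Ici ρ (h.mono subset_union_right)
  let e := Ordinal.enumOrd s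
  have he : StrictMono e := Ordinal.enumOrd_strictMono hs
  obtain ⟨o, ho⟩ : ∃ o, e o = ρ := Ordinal.enumOrd_surjective hs (Or.inr self_mem_Ici)
  have hmem : ∀ {x y}, y ∈ (PFun.res e (Iio (o + 1)) : OrdMap.{u}) x ↔ x < o + 1 ∧ e x = y :=
    PFun.mem_res _ _ _ _
  have hG : OrdMap.IsOP (PFun.res e (Iio (o + 1))) (o + 1) lam.ord := by
    refine OrdMap.IsOP.of_mem (fun x => ?_) (fun x y hy => ?_) (fun x x' y y' hy hy' hlt => ?_)
    · simp [hmem]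
    · obtain ⟨hx, rfl⟩ := hmem.1 hy
      exact (he.monotone (Order.lt_add_one_iff.1 hx)).trans_lt (ho ▸ hρ)
    · obtain ⟨-, rfl⟩ := hmem.1 hy
      obtain ⟨-, rfl⟩ := hmem.1 hy'
      exact he hlt
  -- The values at positions below `o` are distinct elements of `R`, which has fewer than `κ⁺`
  -- elements.
  have hoκ : o < (Order.succ κ).ord := by
    rw [lt_ord, ← Cardinal.lift_lt.{u, u + 1}, ← mk_Iio_ordinal]
    have hin : ∀ i : Iio o, e i ∈ R := fun i =>
      (Ordinal.enumOrd_mem hs i : e i ∈ s).resolve_right fun h => (ho ▸ he i.2).not_ge h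
    refine lt_of_le_of_lt (mk_le_of_injective (f := fun i : Iio o => (⟨e i, hin i⟩ : R)) ?_) hc
    intro i j hij
    exact Subtype.ext (he.injective (congrArg Subtype.val hij))
  refine ⟨o, _, (isSuccLimit_ord (isRegular_succ hκ.aleph0_le).aleph0_le).add_one_lt hoκ, hG,
    fun t f hf hfR => ?_⟩
  have hle : o ≤ o + 1 := Order.le_succ o
  obtain ⟨h, hh, rfl⟩ := (hG.restrict hle).exists_factor hf fun y hy => by
    obtain ⟨x, hx⟩ := Ordinal.enumOrd_surjective hs (Or.inl (hfR hy) : y ∈ s)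
    have hxo : x < o := by
      rw [← he.lt_iff_lt, ho]
      exact hx.trans_lt (hRρ (hfR hy))
    exact ⟨x, OrdMap.mem_comp_idOn.2 ⟨hxo, hmem.2 ⟨hxo.trans_le hle, hx⟩⟩⟩
  exact ⟨h, hh, by rw [PFun.comp_assoc, hh.idOn_comp le_rfl]⟩

theorem OrdMap.IsOP.mk_ran_le {f : OrdMap.{u}} {α β : Ordinal.{u}} (hf : f.IsOP α β) :
    #f.ran ≤ Cardinal.lift.{u + 1} α.card := by
  rw [← mk_Iio_ordinal]
  have key : ∀ y : f.ran, ∃ x : Iio α, y.1 ∈ f x := by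
    rintro ⟨y, x, hx⟩
    exact ⟨⟨x, hf.lt_dom hx⟩, hx⟩
  choose φ hφ using key
  refine mk_le_of_injective (f := φ) fun y y' h => Subtype.ext ?_
  have := hφ y
  rw [h] at this
  exact Part.mem_unique this (hφ y')

/-! ### A common top level along a chain. -/

section AddTopChain

variable {κ : Cardinal.{u}} {Θ Θ' : Set Ordinal.{u}}
  {F F' : Ordinal.{u} → Ordinal.{u} → Set OrdMap.{u}} {t t' τ o : Ordinal.{u}}
  {h h' f : OrdMap.{u}}

theorem IsSegment.addTopMaps_singleton (hS : IsSegment κ Θ F) (hτ : ∀ a ∈ Θ, a < τ) (ht : t ∈ Θ)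
    (hh : h.IsOP t o) : addTopMaps F t τ h t τ = {h} := by
  ext f
  rw [hS.mem_addTopMaps_top hτ ht, hS.self ht]
  simp [hh.comp_idOn_of_le le_rfl]

theorem SegExt.addTop_self (hτ : ∀ a ∈ Θ, a < τ) :
    SegExt Θ F (insert τ Θ) (addTopMaps F t τ h) :=
  ⟨subset_insert _ _, fun _ _ => subset_union_left, fun hab _ =>
    (addTopMaps_of_ne (hτ _ hab.right).ne).symm⟩

/-- A map into the new top of the smaller segment is also one of the larger, because `h` factors
through `h'` by a map of the larger segment. If the same level precedes `τ` in both, then `t = t'`,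
the connecting map is an identity, and `h = h'`. -/
theorem SegExt.addTop (hS : IsSegment κ Θ F) (hS' : IsSegment κ Θ' F') (hext : SegExt Θ F Θ' F')
    (hτ' : ∀ a ∈ Θ', a < τ) (ht : t ∈ Θ) (hm : ∀ a ∈ Θ, a ≤ t) (ht' : t' ∈ Θ')
    (hm' : ∀ a ∈ Θ', a ≤ t') (hh : h.IsOP t o) (hh' : h'.IsOP t' o) (hf : f ∈ F' t t')
    (hhf : h = h'.comp f) :
    SegExt (insert τ Θ) (addTopMaps F t τ h) (insert τ Θ') (addTopMaps F' t' τ h') := by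
  have hτ : ∀ a ∈ Θ, a < τ := fun a ha => hτ' a (hext.levels ha)
  refine ⟨insert_subset_insert hext.levels, ?_, ?_⟩
  · rintro a b g (hg | ⟨rfl, ⟨rfl, rfl⟩ | ⟨g, hg, rfl⟩⟩)
    · exact Or.inl (hext.maps _ _ hg)
    · exact Or.inr ⟨rfl, Or.inl ⟨rfl, rfl⟩⟩
    · refine Or.inr ⟨rfl, Or.inr ⟨f.comp g, ?_, ?_⟩⟩
      · exact (hS'.factor (hm a (hS.supp hg).1) (hm' t (hext.levels ht)) (hext.levels ht)).2
          ⟨g, hext.maps _ _ hg, f, hf, rfl⟩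
      · rw [hhf, PFun.comp_assoc]
  · intro a b hab hab'
    have ha : a ∈ Θ := by
      refine (mem_insert_iff.1 hab.left).resolve_left ?_
      rintro rfl
      rcases mem_insert_iff.1 hab.right with rfl | hb
      · exact hab.lt.false
      · exact hab.lt.not_gt (hτ b hb)
    rcases mem_insert_iff.1 hab.right with rfl | hb
    · obtain rfl : a = t := (hm a ha).antisymm
        (hab.le_of_lt (mem_insert_of_mem _ ht) (hτ t ht))
      obtain rfl : a = t' := (hm' a (hext.levels ha)).antisymm
        (hab'.le_of_lt (mem_insert_of_mem _ ht') (hτ' t' ht'))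
      rw [hS.addTopMaps_singleton hτ ha hh, hS'.addTopMaps_singleton hτ' ht' hh', hhf,
        hS'.eq_idOn hf, hh'.comp_idOn_of_le le_rfl]
    · rw [addTopMaps_of_ne (hτ b hb).ne, addTopMaps_of_ne (hτ b hb).ne]
      exact hext.cover_eq (hab.of_subset (subset_insert _ _) ha hb)
        (hab'.of_subset (subset_insert _ _) (hext.levels ha) (hext.levels hb))

end AddTopChain

/-! ### The lower bound. -/

namespace Condition

variable {κ lam : Cardinal.{u}} {tri : incSeqs κ lam → incSeqs κ lam → Prop}

/-- A descending chain of fewer than `κ` nontrivial conditions has a lower bound. -/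
theorem exists_le_of_chain (hκ : κ.IsRegular) (hlam : lam.IsRegular)
    (hκlam : Order.succ κ < lam) {ι : Type u} [LinearOrder ι] [Nonempty ι] (hι : #ι < κ)
    (p : ι → Condition tri) (hp : ∀ α β, α ≤ β → (p β).Extends (p α)) :
    ∃ q : Condition tri, ∀ α, q.Extends (p α) := by
  let t : ι → Ordinal.{u} := fun α => (p α).S.θ (p α).S.top
  have ht : ∀ α, t α ∈ (p α).S.levels := fun α => SMS.mem_levels _
  have hm : ∀ α, ∀ a ∈ (p α).S.levels, a ≤ t α := fun α a ha => SMS.le_top_level ha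
  have hS := fun α => SMS.isSegment (S := (p α).S) hκ
  have hpe := fun α β hαβ => extends_iff.1 (hp α β hαβ)
  obtain ⟨o, G, hoκ, hG, hfac⟩ := exists_isOP_covering hκ hlam hκlam
    (R := ⋃ α, (p α).F.ran) (iUnion_subset fun α => by
      rintro y ⟨x, hx⟩
      exact (p α).F_isOP.lt x y hx)
    (mk_iUnion_lt_lift (isRegular_succ hκ.aleph0_le) (hι.trans (Order.lt_succ κ)) _ fun α =>
      (p α).F_isOP.mk_ran_le.trans_lt (Cardinal.lift_lt.2 (lt_ord.1 ((p α).S.θ_lt _))))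
  choose h hh hGh using fun α => hfac (t α) (p α).F (p α).F_isOP
    (subset_iUnion (fun α => (p α).F.ran) α)
  have hoτ : o < o + 1 := Order.lt_add_one_iff.2 le_rfl
  set τ := o + 1
  have hτ : ∀ α, ∀ a ∈ (p α).S.levels, a < τ := fun α a ha =>
    ((hm α a ha).trans (hh α).le).trans_lt hoτ
  have hhτ := fun α => (hh α).mono hoτ.le
  let Θ : ι → Set Ordinal.{u} := fun α => insert τ (p α).S.levels
  let F := fun α => addTopMaps (p α).S.maps (t α) τ (h α)
  have hSeg : ∀ α, IsSegment κ (Θ α) (F α) := fun α =>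
    (hS α).addTop hκ (hτ α) (ht α) (hm α) hoκ hoτ (hh α)
  have hCof : ∀ α, HasSmallCof κ (Θ α) := fun α =>
    SMS.hasSmallCof.insert_top (hτ α) (ht α) (hm α)
  have hExt : ∀ α β, α ≤ β → SegExt (Θ α) (F α) (Θ β) (F β) := by
    intro α β hαβ
    obtain ⟨hseg, f, hf, hFf, -⟩ := hpe α β hαβ
    refine hseg.addTop (hS α) (hS β) (hτ β) (ht α) (hm α) (ht β) (hm β) (hh α) (hh β) hf ?_
    -- The maps `h` cohere since the maps `(p α).F` do and `G` is injective.
    refine hG.cancel (hhτ α) ((hhτ β).comp ((hS β).isOP hf)) ?_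
    rw [hGh, hFf, ← PFun.comp_assoc, hGh]
  let Θu := ⋃ α, Θ α
  let Fu := fun a b => ⋃ α, F α a b
  have hSegu : IsSegment κ Θu Fu := IsSegment.iUnion hκ hι hSeg hExt
  have hbd : ∀ b, ∃ ν, IsLim Θu b → ¬ b.cof < κ → ν < b ∧ ν.cof < κ ∧
      ∀ a ∈ Θu, a < b → a < ν ∧ ∀ g ∈ Fu a b, g.ran ⊆ Iio ν := by
    intro b
    by_cases hb : IsLim Θu b ∧ ¬ b.cof < κ
    · obtain ⟨ν, hν⟩ := exists_bound_iUnion hκ hι hSeg hCof hExt hb.1 hb.2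
      exact ⟨ν, fun _ _ => hν⟩
    · exact ⟨0, fun h1 h2 => absurd ⟨h1, h2⟩ hb⟩
  choose ν hν using hbd
  have hν : IsBounding κ Θu Fu ν := hν
  have hτu : τ ∈ Θu := mem_iUnion_of_mem (Classical.arbitrary ι) (mem_insert _ _)
  have hτmax : ∀ a ∈ Θu, a ≤ τ := by
    intro a ha
    obtain ⟨α, ha⟩ := mem_iUnion.1 ha
    rcases mem_insert_iff.1 ha with rfl | ha
    · exact le_rfl
    · exact (hτ α a ha).le
  obtain ⟨S, hSΘ, hSF, hStop⟩ := (hν.isSegment hκ hSegu).exists_sms hν.hasSmallCof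
    (subset_insertLevels hτu) fun a ha => (hν.le_levelCeil ha).trans
      (hτmax _ (hν.levelCeil_mem ha))
  have hSext : ∀ α, SegExt (p α).S.levels (p α).S.maps S.levels S.maps := by
    intro α
    rw [hSΘ, hSF]
    exact (SegExt.addTop_self (hτ α)).trans
      ((SegExt.iUnion hExt α).trans (IsBounding.segExt hSegu))
  have hhS : ∀ α, h α ∈ S.maps (t α) (S.θ S.top) := by
    intro α
    rw [hSF, hStop]
    refine (IsBounding.segExt hSegu).maps _ _ ((SegExt.iUnion hExt α).maps _ _ ?_)
    change h α ∈ addTopMaps _ _ _ _ _ _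
    rw [(hS α).addTopMaps_singleton (hτ α) (ht α) (hh α)]
    exact mem_singleton _
  have hS' : IsSegment κ S.levels S.maps := SMS.isSegment hκ
  have hGop : G.IsOP (S.θ S.top) lam.ord := hStop ▸ hG
  have hcomp : ∀ {M i f}, IsWitness lam S G M i f → OrdMap.IsOP (G.comp f) (S.θ i) lam.ord :=
    fun hw => hGop.comp (S.F_isOP _ _ (SMS.le_of_mem hw.1) _ hw.1)
  -- Both `G ∘ f` and `G ∘ f'` enumerate `M ∩ λ` increasingly, so they agree, domains included; then
  -- `G` cancels.
  have huniq : ∀ {M i f i' f'}, IsWitness lam S G M i f → IsWitness lam S G M i' f' →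
      i = i' ∧ f = f' := by
    intro M i f i' f' hw hw'
    obtain ⟨h1, h2⟩ := (hcomp hw).eq_of_ran_eq (hcomp hw') (hw.2.trans hw'.2.symm)
    exact ⟨S.θ_strictMono.injective h1, hGop.cancel (S.F_isOP _ _ (SMS.le_of_mem hw.1) _ hw.1)
      (S.F_isOP _ _ (SMS.le_of_mem hw'.1) _ hw'.1) h2⟩
  have hlift : ∀ α, ∀ M, ∀ i f, IsWitness lam (p α).S (p α).F M i f →
      ∃ i', S.θ i' = (p α).S.θ i ∧ IsWitness lam S G M i' ((h α).comp f) := by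
    intro α M i f hw
    obtain ⟨i', hi'⟩ := (hSext α).levels (SMS.mem_levels i)
    refine ⟨i', hi', ?_, ?_⟩
    · rw [← SMS.mem_maps, hi']
      exact (hS'.factor (hm α _ (SMS.mem_levels i)) (SMS.le_top_level ((hSext α).levels (ht α)))
        ((hSext α).levels (ht α))).2 ⟨f, (hSext α).maps _ _ (SMS.mem_maps.2 hw.1), h α, hhS α, rfl⟩
    · rw [← PFun.comp_assoc, hGh]
      exact hw.2
  -- By uniqueness, the level of a model in the new condition is its level at any stage that
  -- contains it; in particular it is never an inserted level or the new top.
  have hwit : ∀ α, ∀ M ∈ (p α).𝒩, ∀ iM fM, IsWitness lam S G M iM fM →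
      ∃ i f, IsWitness lam (p α).S (p α).F M i f ∧ S.θ iM = (p α).S.θ i := by
    intro α M hM iM fM hw
    obtain ⟨⟨i, f⟩, hif, -⟩ := (p α).witness M hM
    obtain ⟨i', hi', hw'⟩ := hlift α M i f hif
    exact ⟨i, f, hif, (huniq hw hw').1 ▸ hi'⟩
  have h𝒩 : ∀ {α β}, α ≤ β → (p α).𝒩 ⊆ (p β).𝒩 := by
    intro α β hαβ
    obtain ⟨-, -, -, -, h, -⟩ := hpe α β hαβ
    exact h
  have hvg : ∀ M ∈ ⋃ α, (p α).𝒩, IsVeryGoodModel tri M := by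
    intro M hM
    obtain ⟨α, hM⟩ := mem_iUnion.1 hM
    exact (p α).veryGood M hM
  let q : Condition tri :=
    { S := S
      F := G
      𝒩 := ⋃ α, (p α).𝒩
      F_isOP := hGop
      veryGood := hvg
      witness := by
        intro M hM
        obtain ⟨α, hM⟩ := mem_iUnion.1 hM
        obtain ⟨⟨i, f⟩, hif, -⟩ := (p α).witness M hM
        obtain ⟨i', -, hw'⟩ := hlift α M i f hif
        refine ⟨(i', _), hw', fun w hw => ?_⟩
        obtain ⟨h1, h2⟩ := huniq hw hw'
        exact Prod.ext h1 h2
      circ₁ := by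
        intro M hM iM fM hw i j hij hjM hiM f hf
        have helem := (hvg M hM).elementary
        obtain ⟨α, hM⟩ := mem_iUnion.1 hM
        rw [← SMS.mem_maps, hSF] at hf
        obtain ⟨-, hj, -, g, hg, rfl⟩ := hf
        have hxM : (S.θ i).toZFSet ∈ collapse M :=
          Fits.toZFSet_mem_collapse hw.2 (hcomp hw) (S.θ_strictMono hiM)
        obtain ⟨i₀, -, -, hi₀⟩ := hwit α M hM iM fM hw
        have hzu : S.θ iM ∈ Θu := by
          rw [hi₀]
          exact mem_iUnion_of_mem α (mem_insert_of_mem _ (SMS.mem_levels _))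
        have hcy : levelCeil Θu (S.θ j) ≤ S.θ iM :=
          levelCeil_le hzu (S.θ_strictMono.monotone hjM)
        have hcxy := (hSegu.supp hg).2.2
        -- If the ceiling of the source is the level of `M`, both ceilings equal that level and the
        -- map is an identity. Otherwise it restricts an old map to which the first condition on `M`
        -- applies at a common stage.
        rcases (hcxy.trans hcy).eq_or_lt with he | hlt
        · rw [he, hcy.antisymm (he ▸ hcxy)] at hg
          rw [hSegu.eq_idOn hg, OrdMap.idOn_comp_idOn (S.θ_strictMono hiM).le]
          exact helem.idOn_memSet hlam.aleph0_le hxM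
        · obtain ⟨β, hg⟩ := mem_iUnion.1 hg
          have hMγ := h𝒩 (le_max_left α β) hM
          have hg := (hExt _ _ (le_max_right α β)).maps _ _ hg
          obtain ⟨k, fk, hwk, hk⟩ := hwit _ M hMγ iM fM hw
          -- The level of `M` is an old one, hence below the new top, so `g` is a map of the stage
          -- itself.
          have hne : levelCeil Θu (S.θ j) ≠ τ := by
            refine (hcy.trans_lt ?_).ne
            rw [hk]
            exact hτ _ _ (SMS.mem_levels _)
          change g ∈ addTopMaps _ _ _ _ _ _ at hg
          rw [addTopMaps_of_ne hne] at hg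
          obtain ⟨k₀, k₁, hk₀, hk₁, hg⟩ := hg
          refine helem.restrict_memSet ?_ hxM
          refine (p (max α β)).circ₁ M hMγ k fk hwk k₀ k₁ (SMS.le_of_mem hg) ?_ ?_ g hg
          · rw [← (p (max α β)).S.θ_strictMono.le_iff_le, hk₁, ← hk]
            exact hcy
          · rw [← (p (max α β)).S.θ_strictMono.lt_iff_lt, hk₀, ← hk]
            exact hlt
      circ₂ := by
        intro M hM iM fM hwM N hN iN fN hwN γ hγ g hg hle hgN
        obtain ⟨α, hM⟩ := mem_iUnion.1 hM
        obtain ⟨β, hN⟩ := mem_iUnion.1 hN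
        have hM' := h𝒩 (le_max_left α β) hM
        have hN' := h𝒩 (le_max_right α β) hN
        obtain ⟨k, fk, hwk, hk⟩ := hwit _ M hM' iM fM hwM
        obtain ⟨l, fl, hwl, hl⟩ := hwit _ N hN' iN fN hwN
        refine (p (max α β)).circ₂ M hM' k fk hwk N hN' l fl hwl γ hγ g (hl ▸ hg) ?_ hgN
        rw [← (p (max α β)).S.θ_strictMono.le_iff_le, ← hk, ← hl]
        exact S.θ_strictMono.monotone hle }
  refine ⟨q, fun α => extends_iff.2 ⟨hSext α, h α, hhS α, (hGh α).symm,
    subset_iUnion (fun α => (p α).𝒩) α, fun N hN a g hg hfit => ?_⟩⟩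
  -- A model that entered at stage `β` is present at a stage below both conditions, and that stage
  -- extends `p α`, so the last clause of the order applies there.
  obtain ⟨β, hN⟩ := mem_iUnion.1 hN
  obtain ⟨-, -, -, -, -, hW⟩ := hpe α _ (le_max_left α β)
  exact hW N (h𝒩 (le_max_right α β) hN) a g hg hfit

end Condition

theorem mainTheorem5 (κ lam : Cardinal.{u}) (hκ : κ.IsRegular) (hlam : lam.IsRegular)
    (hκlam : Order.succ κ < lam) (hpow : (2 : Cardinal.{u}) ^ κ ≤ lam)
    (tri : incSeqs κ lam → incSeqs κ lam → Prop) [IsWellOrder (incSeqs κ lam) tri]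
    (htri : Ordinal.type tri = Ordinal.lift.{u + 1} lam.ord) :
    IsLTClosed κ (MorassForcing tri) := by
  intro μ hμ p hp
  -- Trivial conditions constrain nothing and are dropped; if none remain, the trivial condition is
  -- a lower bound. Indexing by `μ.ToType` instead of `Iio μ` keeps the index type in the universe
  -- of `κ`.
  let ι := {x : μ.ToType // p x.toOrd ≠ ⊤}
  have hι : #ι < κ := by
    refine (mk_subtype_le _).trans_lt ?_
    rw [mk_toType]
    exact lt_ord.1 hμ
  rcases isEmpty_or_nonempty ι with hemp | hne
  · refine ⟨⊤, fun α => le_of_eq ?_⟩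
    by_contra h
    refine hemp.false ⟨Ordinal.ToType.mk α, ?_⟩
    rw [Ordinal.ToType.toOrd, OrderIso.symm_apply_apply]
    exact Ne.symm h
  · choose P hP using fun x : ι => WithTop.ne_top_iff_exists.1 x.2
    obtain ⟨q, hq⟩ := Condition.exists_le_of_chain hκ hlam hκlam hι P fun x y hxy => by
      have := hp ((Ordinal.ToType.mk.symm).monotone hxy)
      change p y.1.toOrd ≤ p x.1.toOrd at this
      rw [← hP, ← hP] at this
      exact WithTop.coe_le_coe.1 this
    refine ⟨(q : WithTop (Condition tri)), fun α => ?_⟩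
    by_cases h : p α = ⊤
    · rw [h]
      exact le_top
    · let x : ι := ⟨Ordinal.ToType.mk α, by
        rwa [Ordinal.ToType.toOrd, OrderIso.symm_apply_apply]⟩
      have hx : p α = P x := by
        rw [hP x, Ordinal.ToType.toOrd, OrderIso.symm_apply_apply]
      rw [hx]
      exact WithTop.coe_le_coe.2 (hq x)
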